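/- **(I)** There exist a real-valued function $Q(s,x)\in C^\infty([0,1]^2)$ with $Q(s,x)>0$ for all $(s,x)\in[0,1]^2$ and $Q(s,x)=1$ whenever $s\ge 1/3$, and a real-valued function $b\in C_c^\infty([0,1/3))$ (smooth up to the endpoint $0$, vanishing outside a compact subset of $[0,1/3)$, and extended by zero to $[0,1]$), with $b\not\equiv 0$, such that for some $\delta\in(0,1]$ $$\int_0^1 e^{-s/x}\,Q(s,x)\,b(s)\,ds=0\qquad\text{for all }x\in(0,\delta].$$ **(II)** Let $b(t,s)$ be a (real- or complex-valued) continuous function on $[0,1]^2$ such that $\partial_s b(t,s)$ exists (one-sided at $s=0,1$) and is continuous on $[0,1]^2$, and such that $b(t,0)$ is real and $b(t,0)>0$ for every $t\in[0,1]$. Let $G(t,x)$ be a bounded measurable function on $[0,1]^2$; more generally, it suffices that the functions $t\mapsto G(t,1/n)$, $n=1,2,3,\dots$, are measurable and essentially bounded on $[0,1]$ with a bound independent of $n$. For $x\in(0,1]$ set $$Q(t,x):=\frac1x\int_0^1 e^{-s/x}\,b(t,s)\,ds+e^{-1/x}\,G(t,x).$$ Let $a\in L^1([0,1])$ and suppose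 that there is a constant $C$ such that for all $x>0$ with $1/x\in\{1,2,3,\dots\}$ $$\left|\int_0^1 e^{-t/x}\,Q(t,x)\,a(t)\,dt\right|\le C\,e^{-1/x}.$$ Then $a=0$ almost everywhere on $[0,1]$. -/

import Mathlib

open Set Filter Topology MeasureTheory
open scoped ContDiff

/-- The closed unit square `[0,1]²`, as a subset of `ℝ × ℝ`. -/
def unitSquare : Set (ℝ × ℝ) := Icc (0 : ℝ) 1 ×ˢ Icc (0 : ℝ) 1

/-- `f ∈ C_c^∞([0, r))`: `f` is smooth on `[0, r)` (up to and including the endpoint `0`, with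
one-sided derivatives there) and vanishes off a compact subset of `[0, r)`. The support may
contain `0`; `f` is extended by zero outside `[0, r)`. -/
def IsSmoothCompactlySupportedIco (r : ℝ) (f : ℝ → ℝ) : Prop :=
  ContDiffOn ℝ ∞ f (Ico 0 r) ∧
    ∃ K : Set ℝ, IsCompact K ∧ K ⊆ Ico 0 r ∧ ∀ s, s ∉ K → f s = 0

/-- The weight `Q(t,x) = (1/x) ∫₀¹ e^{-s/x} b(t,s) ds + e^{-1/x} G(t,x)`, meant for `x > 0`. -/
noncomputable def laplaceWeight {𝕜 : Type*} [RCLike 𝕜] (b G : ℝ → ℝ → 𝕜) (t x : ℝ) : 𝕜 :=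
  ((1 / x : ℝ) : 𝕜) * (∫ s in (0 : ℝ)..1, ((Real.exp (-s / x) : ℝ) : 𝕜) * b t s) +
    ((Real.exp (-1 / x) : ℝ) : 𝕜) * G t x

/-- The function `x ↦ H (1 / √x)` on `(0, ∞)`, extended by zero to the real line. -/
noncomputable def invSqrtExt (H : ℝ → ℂ) (x : ℝ) : ℂ := if 0 < x then H (√x)⁻¹ else 0

theorem invSqrtExt_of_pos (H : ℝ → ℂ) {x : ℝ} (hx : 0 < x) : invSqrtExt H x = H (√x)⁻¹ :=
  if_pos hx

theorem invSqrtExt_of_nonpos (H : ℝ → ℂ) {x : ℝ} (hx : x ≤ 0) : invSqrtExt H x = 0 :=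
  if_neg hx.not_gt

theorem tendsto_inv_sqrt_nhdsGT_zero : Tendsto (fun x : ℝ => (√x)⁻¹) (𝓝[>] 0) atTop := by
  refine tendsto_inv_nhdsGT_zero.comp ?_
  refine tendsto_nhdsWithin_of_tendsto_nhds_of_eventually_within _ ?_ ?_
  · have := Real.continuous_sqrt.tendsto 0
    rw [Real.sqrt_zero] at this
    exact this.mono_left nhdsWithin_le_nhds
  · filter_upwards [self_mem_nhdsWithin] with x hx
    exact Real.sqrt_pos.2 hx

theorem hasDerivAt_inv_sqrt {x : ℝ} (hx : 0 < x) :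
    HasDerivAt (fun x : ℝ => (√x)⁻¹) (-(1 / 2) * (√x)⁻¹ ^ 3) x := by
  have hs : 0 < √x := Real.sqrt_pos.2 hx
  refine ((Real.hasDerivAt_sqrt hx.ne').inv hs.ne').congr_deriv ?_
  field_simp

theorem hasDerivAt_invSqrtExt {H g : ℝ → ℂ}
    (hdecay : Tendsto (fun u : ℝ => (u : ℂ) ^ 2 * H u) atTop (𝓝 0))
    (hderiv : ∀ u : ℝ, 0 < u → HasDerivAt H (-2 * (u : ℂ)⁻¹ ^ 3 * g u) u) (x : ℝ) :
    HasDerivAt (invSqrtExt H) (invSqrtExt g x) x := by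
  rcases lt_trichotomy x 0 with hx | rfl | hx
  · rw [invSqrtExt_of_nonpos g hx.le]
    refine (hasDerivAt_const x (0 : ℂ)).congr_of_eventuallyEq ?_
    filter_upwards [Iio_mem_nhds hx] with y hy
    exact invSqrtExt_of_nonpos H hy.le
  · rw [invSqrtExt_of_nonpos g le_rfl, hasDerivAt_iff_isLittleO, Asymptotics.isLittleO_iff]
    intro c hc
    have h1 := (tendsto_zero_iff_norm_tendsto_zero.1
      (hdecay.comp tendsto_inv_sqrt_nhdsGT_zero)).eventually (Iic_mem_nhds hc)
    filter_upwards [eventually_nhdsWithin_iff.1 h1] with y hy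
    rw [invSqrtExt_of_nonpos H le_rfl]
    rcases le_or_gt y 0 with h | h
    · rw [invSqrtExt_of_nonpos H h]
      simp only [sub_zero, smul_zero, norm_zero]
      positivity
    · have h2 := hy h
      rw [invSqrtExt_of_pos H h]
      simp only [Function.comp_apply, norm_mul, norm_pow, Complex.norm_real, norm_inv,
        Real.norm_eq_abs, inv_pow, sq_abs, Real.sq_sqrt h.le, Complex.ofReal_inv] at h2
      simp only [sub_zero, smul_zero, Real.norm_eq_abs, abs_of_pos h]
      rwa [inv_mul_le_iff₀ h, mul_comm] at h2
  · rw [invSqrtExt_of_pos g hx]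
    have hs : 0 < √x := Real.sqrt_pos.2 hx
    have h1 := (hderiv _ (inv_pos.2 hs)).scomp x (hasDerivAt_inv_sqrt hx)
    have h2 : HasDerivAt (H ∘ fun x : ℝ => (√x)⁻¹) (g (√x)⁻¹) x := by
      refine h1.congr_deriv ?_
      have : ((√x : ℝ) : ℂ) ≠ 0 := by exact_mod_cast hs.ne'
      rw [Complex.real_smul]
      push_cast
      field_simp
    refine h2.congr_of_eventuallyEq ?_
    filter_upwards [Ioi_mem_nhds hx] with y hy
    exact invSqrtExt_of_pos H hy

/-- If a family of functions of `u` decays and its linear span is stable under `-(u³/2) d/du`,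
the members of the span become smooth functions of `x` under `u = 1 / √x`. -/
theorem contDiff_invSqrtExt {B : Set (ℝ → ℂ)}
    (hdecay : ∀ H ∈ B, Tendsto (fun u : ℝ => (u : ℂ) ^ 2 * H u) atTop (𝓝 0))
    (hderiv : ∀ H ∈ B, ∃ g ∈ Submodule.span ℂ B, ∀ u : ℝ, 0 < u →
      HasDerivAt H (-2 * (u : ℂ)⁻¹ ^ 3 * g u) u)
    {H : ℝ → ℂ} (hH : H ∈ Submodule.span ℂ B) : ContDiff ℝ ∞ (invSqrtExt H) := by
  have hdecay' : ∀ H ∈ Submodule.span ℂ B,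
      Tendsto (fun u : ℝ => (u : ℂ) ^ 2 * H u) atTop (𝓝 0) := by
    intro H hH
    induction hH using Submodule.span_induction with
    | mem H h => exact hdecay H h
    | zero => simp
    | add f g _ _ hf hg => simpa [mul_add] using hf.add hg
    | smul c f _ hf => simpa [mul_left_comm] using hf.const_mul c
  have hderiv' : ∀ H ∈ Submodule.span ℂ B, ∃ g ∈ Submodule.span ℂ B, ∀ u : ℝ, 0 < u →
      HasDerivAt H (-2 * (u : ℂ)⁻¹ ^ 3 * g u) u := by
    intro H hH
    induction hH using Submodule.span_induction with
    | mem H h => exact hderiv H h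
    | zero => exact ⟨0, zero_mem _, fun u _ => (hasDerivAt_const u (0 : ℂ)).congr_deriv (by simp)⟩
    | add f g _ _ hf hg =>
      obtain ⟨f', hf', hf⟩ := hf
      obtain ⟨g', hg', hg⟩ := hg
      refine ⟨f' + g', add_mem hf' hg', fun u hu => ((hf u hu).add (hg u hu)).congr_deriv ?_⟩
      simp [mul_add]
    | smul c f _ hf =>
      obtain ⟨f', hf', hf⟩ := hf
      refine ⟨c • f', Submodule.smul_mem _ c hf', fun u hu =>
        ((hf u hu).const_smul c).congr_deriv ?_⟩
      simp [mul_left_comm]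
  refine contDiff_infty.2 fun n => ?_
  induction n generalizing H with
  | zero =>
    obtain ⟨g, -, h⟩ := hderiv' H hH
    exact contDiff_zero.2 (continuous_iff_continuousAt.2 fun x =>
      (hasDerivAt_invSqrtExt (hdecay' H hH) h x).continuousAt)
  | succ n ih =>
    obtain ⟨g, hg, h⟩ := hderiv' H hH
    have hd := hasDerivAt_invSqrtExt (hdecay' H hH) h
    rw [show ((n + 1 : ℕ) : WithTop ℕ∞) = (n : WithTop ℕ∞) + 1 by norm_cast,
      contDiff_succ_iff_deriv]
    refine ⟨fun x => (hd x).differentiableAt, by simp, ?_⟩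
    rw [show deriv (invSqrtExt H) = invSqrtExt g from funext fun x => (hd x).deriv]
    exact ih hg

/-- The functions `uⁿ exp (-(w u + z u²))`. -/
noncomputable def powGauss (w z : ℂ) (n : ℕ) (u : ℝ) : ℂ :=
  (u : ℂ) ^ n * Complex.exp (-(w * u + z * (u : ℂ) ^ 2))

theorem hasDerivAt_powGauss (w z : ℂ) (n : ℕ) (u : ℝ) :
    HasDerivAt (powGauss w z n)
      (n * (u : ℂ) ^ (n - 1) * Complex.exp (-(w * u + z * (u : ℂ) ^ 2)) +
        (u : ℂ) ^ n * (Complex.exp (-(w * u + z * (u : ℂ) ^ 2)) * -(w + z * (2 * u)))) u := by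
  have h0 : HasDerivAt (fun u : ℝ => (u : ℂ)) 1 u := Complex.ofRealCLM.hasDerivAt
  have h1 : HasDerivAt (fun u : ℝ => (u : ℂ) ^ n) (n * (u : ℂ) ^ (n - 1)) u := by
    simpa using h0.fun_pow n
  have h2 : HasDerivAt (fun u : ℝ => (u : ℂ) ^ 2) (2 * u) u := by
    simpa using h0.fun_pow 2
  exact h1.mul (((h0.const_mul w).fun_add (h2.const_mul z)).fun_neg.cexp.congr_deriv (by ring))

theorem contDiff_invSqrtExt_powGauss {w z : ℂ}
    (h : ∀ n : ℕ, Tendsto (powGauss w z n) atTop (𝓝 0)) (n : ℕ) :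
    ContDiff ℝ ∞ (invSqrtExt (powGauss w z n)) := by
  refine contDiff_invSqrtExt (B := range (powGauss w z)) ?_ ?_
    (Submodule.subset_span (mem_range_self n))
  · rintro _ ⟨n, rfl⟩
    refine (h (n + 2)).congr fun u => ?_
    simp only [powGauss]
    ring
  · rintro _ ⟨n, rfl⟩
    have hm : ∀ k, powGauss w z k ∈ Submodule.span ℂ (range (powGauss w z)) := fun k =>
      Submodule.subset_span (mem_range_self k)
    refine ⟨(-(n : ℂ) / 2) • powGauss w z (n + 2) + ((w / 2) • powGauss w z (n + 3) +
      z • powGauss w z (n + 4)), add_mem (Submodule.smul_mem _ _ (hm _))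
      (add_mem (Submodule.smul_mem _ _ (hm _)) (Submodule.smul_mem _ _ (hm _))), fun u hu => ?_⟩
    refine (hasDerivAt_powGauss w z n u).congr_deriv ?_
    have hu' : (u : ℂ) ≠ 0 := by exact_mod_cast hu.ne'
    simp only [powGauss, Pi.add_apply, Pi.smul_apply, smul_eq_mul]
    rcases n with _ | n
    · simp
      field_simp
      ring
    · simp
      field_simp
      ring

theorem norm_powGauss (w z : ℂ) (n : ℕ) (u : ℝ) :
    ‖powGauss w z n u‖ = |u| ^ n * Real.exp (-(w.re * u + z.re * u ^ 2)) := by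
  simp only [powGauss, norm_mul, norm_pow, Complex.norm_real, Real.norm_eq_abs, Complex.norm_exp]
  congr 2
  rw [← Complex.ofReal_pow, Complex.neg_re, Complex.add_re, Complex.re_mul_ofReal,
    Complex.re_mul_ofReal]

theorem tendsto_pow_mul_exp_neg (n : ℕ) {c : ℝ} (hc : 0 < c) :
    Tendsto (fun u : ℝ => u ^ n * Real.exp (-(c * u))) atTop (𝓝 0) := by
  have h := (Real.tendsto_pow_mul_exp_neg_atTop_nhds_zero n).comp (tendsto_id.const_mul_atTop hc)
  have h2 := h.const_mul ((c ^ n)⁻¹)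
  rw [mul_zero] at h2
  refine h2.congr fun u => ?_
  simp only [Function.comp_apply, id, mul_pow]
  field_simp

theorem tendsto_powGauss_linear {w : ℂ} (hw : 0 < w.re) (n : ℕ) :
    Tendsto (powGauss w 0 n) atTop (𝓝 0) := by
  rw [tendsto_zero_iff_norm_tendsto_zero]
  refine (tendsto_pow_mul_exp_neg n hw).congr' ?_
  filter_upwards [eventually_ge_atTop 0] with u hu
  rw [norm_powGauss, abs_of_nonneg hu]
  simp

theorem tendsto_powGauss_quadratic {w z : ℂ} (hz : 0 < z.re) (n : ℕ) :
    Tendsto (powGauss w z n) atTop (𝓝 0) := by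
  rw [tendsto_zero_iff_norm_tendsto_zero]
  refine squeeze_zero' (Eventually.of_forall fun u => norm_nonneg _) ?_
    (tendsto_pow_mul_exp_neg n one_pos)
  filter_upwards [eventually_ge_atTop (max 0 ((1 - w.re) / z.re))] with u hu
  have h0 : 0 ≤ u := (le_max_left _ _).trans hu
  have h1 : 1 - w.re ≤ u * z.re := (div_le_iff₀ hz).1 ((le_max_right _ _).trans hu)
  rw [norm_powGauss, abs_of_nonneg h0]
  gcongr
  nlinarith

theorem exists_odd_primitive_gaussian :
    ∃ E : ℂ → ℂ, (∀ z, HasDerivAt E (Complex.exp (-z ^ 2)) z) ∧ ∀ z, E (-z) = -E z := by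
  have hd : Differentiable ℂ fun z : ℂ => Complex.exp (-z ^ 2) := by fun_prop
  obtain ⟨g, hg⟩ := hd.isExactOn_univ
  refine ⟨fun z => (g z - g (-z)) / 2, fun z => ?_, fun z => by simp only [neg_neg]; ring⟩
  have h1 := hg z (mem_univ _)
  have h2 := (hg (-z) (mem_univ _)).scomp z (hasDerivAt_neg z)
  refine ((h1.sub h2).div_const 2).congr_deriv ?_
  simp

theorem convex_sector : Convex ℝ {z : ℂ | |z.im| ≤ z.re} := by
  intro x hx y hy a b ha hb _
  simp only [mem_ofPred_eq, abs_le] at hx hy ⊢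
  simp only [Complex.add_re, Complex.add_im, Complex.real_smul, Complex.re_ofReal_mul,
    Complex.im_ofReal_mul]
  constructor <;> nlinarith [mul_le_mul_of_nonneg_left hx.1 ha, mul_le_mul_of_nonneg_left hx.2 ha,
    mul_le_mul_of_nonneg_left hy.1 hb, mul_le_mul_of_nonneg_left hy.2 hb]

theorem re_sq_pos_of_abs_im_lt_re {p : ℂ} (hp : |p.im| < p.re) : 0 < (p ^ 2).re := by
  have := sq_lt_sq' (by linarith [abs_nonneg p.im, neg_abs_le p.im]) ((le_abs_self _).trans_lt hp)
  rw [pow_two, Complex.mul_re]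
  nlinarith

theorem norm_gaussianPrimitive_sub_le {E : ℂ → ℂ}
    (hE : ∀ z, HasDerivAt E (Complex.exp (-z ^ 2)) z) {z w : ℂ}
    (hz : |z.im| ≤ z.re) (hw : |w.im| ≤ w.re) : ‖E z - E w‖ ≤ ‖z - w‖ := by
  have := convex_sector.norm_image_sub_le_of_norm_hasDerivWithin_le (f := E) (C := 1)
    (fun x _ => (hE x).hasDerivWithinAt) (fun x hx => ?_) hw hz
  · simpa using this
  · rw [Complex.norm_exp, Real.exp_le_one_iff]
    have h : |x.im| ≤ x.re := hx
    have := sq_le_sq' (by linarith [abs_nonneg x.im, neg_abs_le x.im]) ((le_abs_self _).trans h)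
    rw [Complex.neg_re, pow_two, Complex.mul_re]
    nlinarith

theorem tendsto_gaussianPrimitive_of_sub_tendsto_zero {E : ℂ → ℂ}
    (hE : ∀ z, HasDerivAt E (Complex.exp (-z ^ 2)) z) {ι : Type*} {l : Filter ι} {z w : ι → ℂ}
    {G : ℂ} (hz : ∀ᶠ i in l, |(z i).im| ≤ (z i).re) (hw : ∀ᶠ i in l, |(w i).im| ≤ (w i).re)
    (hzw : Tendsto (fun i => z i - w i) l (𝓝 0)) (hG : Tendsto (fun i => E (w i)) l (𝓝 G)) :
    Tendsto (fun i => E (z i)) l (𝓝 G) := by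
  have h : Tendsto (fun i => E (z i) - E (w i)) l (𝓝 0) := by
    rw [tendsto_zero_iff_norm_tendsto_zero] at hzw ⊢
    refine squeeze_zero' (Eventually.of_forall fun i => norm_nonneg _) ?_ hzw
    filter_upwards [hz, hw] with i h1 h2 using norm_gaussianPrimitive_sub_le hE h1 h2
  simpa using h.add hG

theorem tendsto_gaussianPrimitive_mul_atTop {E : ℂ → ℂ}
    (hE : ∀ z, HasDerivAt E (Complex.exp (-z ^ 2)) z) (hodd : ∀ z, E (-z) = -E z)
    {p : ℂ} (hp : |p.im| < p.re) :
    Tendsto (fun r : ℝ => E (p * r)) atTop (𝓝 (√Real.pi / 2 : ℝ)) := by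
  have hre : 0 < p.re := (abs_nonneg _).trans_lt hp
  have hp0 : p ≠ 0 := fun h => by simp [h] at hre
  have hE0 : E 0 = 0 := by
    have := hodd 0
    rw [neg_zero] at this
    exact self_eq_neg.1 this
  have hsq := re_sq_pos_of_abs_im_lt_re hp
  have hint := (integrable_cexp_neg_mul_sq hsq).integrableOn (s := Ioi 0)
  have h1 := (intervalIntegral_tendsto_integral_Ioi 0 hint tendsto_id).const_mul p
  have hval : p * ∫ x : ℝ in Ioi 0, Complex.exp (-p ^ 2 * (x : ℂ) ^ 2) =
      ((√Real.pi / 2 : ℝ) : ℂ) := by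
    rw [integral_gaussian_complex_Ioi hsq]
    have hs : ((√Real.pi : ℝ) : ℂ) ^ 2 = (Real.pi : ℂ) := by
      rw [← Complex.ofReal_pow, Real.sq_sqrt Real.pi_pos.le]
    have h2 : (Real.pi : ℂ) / p ^ 2 = ((√Real.pi : ℝ) / p) ^ 2 := by rw [div_pow, hs]
    rw [h2, one_div, Complex.sq_cpow_two_inv]
    · push_cast
      field_simp
    · rw [Complex.div_re]
      simp only [Complex.ofReal_re, Complex.ofReal_im, zero_mul, zero_div, add_zero]
      have := Real.sqrt_pos.2 Real.pi_pos
      have := Complex.normSq_pos.2 hp0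
      positivity
  rw [hval] at h1
  refine h1.congr fun r => ?_
  have hd : ∀ x ∈ uIcc 0 r, HasDerivAt (fun x : ℝ => E (p * x))
      (p * Complex.exp (-p ^ 2 * (x : ℂ) ^ 2)) x := by
    intro x _
    have h0 : HasDerivAt (fun x : ℝ => p * (x : ℂ)) (p * 1) x :=
      (Complex.ofRealCLM.hasDerivAt (x := x)).const_mul p
    refine ((hE (p * x)).scomp x h0).congr_deriv ?_
    simp only [smul_eq_mul, mul_one]
    congr 2
    ring
  have := intervalIntegral.integral_eq_sub_of_hasDerivAt hd
    (Continuous.intervalIntegrable (by fun_prop) _ _)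
  rw [intervalIntegral.integral_const_mul] at this
  simpa [hE0] using this

theorem integral_exp_neg_sq_add_inv_sq {p : ℂ} (hp : |p.im| < p.re) {v : ℝ} (hv : 0 < v) :
    ∫ r : ℝ in Ioi 0, Complex.exp (-(p ^ 2 * (r : ℂ) ^ 2 + (v : ℂ) ^ 2 / (r : ℂ) ^ 2)) =
      (√Real.pi : ℝ) / (2 * p) * Complex.exp (-(2 * p * v)) := by
  obtain ⟨E, hE, hodd⟩ := exists_odd_primitive_gaussian
  have hre : 0 < p.re := (abs_nonneg _).trans_lt hp
  have hp0 : p ≠ 0 := fun h => by simp [h] at hre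
  have hsq := re_sq_pos_of_abs_im_lt_re hp
  set G : ℂ := ((√Real.pi / 2 : ℝ) : ℂ) with hGdef
  set W : ℝ → ℂ := fun r => Complex.exp (-(2 * p * v)) * E (p * r - v / r) +
    Complex.exp (2 * p * v) * E (p * r + v / r) with hW
  have him : ∀ r : ℝ, (p * r).im = p.im * r := fun r => by simp
  have hre' : ∀ r : ℝ, (p * r).re = p.re * r := fun r => by simp
  have hvim : ∀ r : ℝ, ((v : ℂ) / r).im = 0 := fun r => by
    rw [← Complex.ofReal_div, Complex.ofReal_im]
  have hvre : ∀ r : ℝ, ((v : ℂ) / r).re = v / r := fun r => by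
    rw [← Complex.ofReal_div, Complex.ofReal_re]
  have hderiv : ∀ r ∈ Ioi (0 : ℝ), HasDerivAt W
      (2 * p * Complex.exp (-(p ^ 2 * (r : ℂ) ^ 2 + (v : ℂ) ^ 2 / (r : ℂ) ^ 2))) r := by
    intro r hr
    have hr0 : (r : ℂ) ≠ 0 := by exact_mod_cast (ne_of_gt hr)
    have h0 : HasDerivAt (fun x : ℝ => (x : ℂ)) 1 r := Complex.ofRealCLM.hasDerivAt
    have h1 := h0.const_mul p
    have h2 : HasDerivAt (fun x : ℝ => (v : ℂ) / x) (-(v / (r : ℂ) ^ 2)) r := by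
      refine ((hasDerivAt_const r (v : ℂ)).div h0 hr0).congr_deriv ?_
      simp [neg_div]
    have h3 := ((hE (p * r - v / r)).scomp r (h1.fun_sub h2)).const_mul
      (Complex.exp (-(2 * p * v)))
    have h4 := ((hE (p * r + v / r)).scomp r (h1.fun_add h2)).const_mul (Complex.exp (2 * p * v))
    refine (h3.fun_add h4).congr_deriv ?_
    have e1 : Complex.exp (-(2 * p * v)) * Complex.exp (-(p * r - v / r) ^ 2) =
        Complex.exp (-(p ^ 2 * (r : ℂ) ^ 2 + (v : ℂ) ^ 2 / (r : ℂ) ^ 2)) := by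
      rw [← Complex.exp_add]
      congr 1
      field_simp
      ring
    have e2 : Complex.exp (2 * p * v) * Complex.exp (-(p * r + v / r) ^ 2) =
        Complex.exp (-(p ^ 2 * (r : ℂ) ^ 2 + (v : ℂ) ^ 2 / (r : ℂ) ^ 2)) := by
      rw [← Complex.exp_add]
      congr 1
      field_simp
      ring
    simp only [smul_eq_mul, mul_one]
    rw [mul_left_comm, e1, mul_left_comm (Complex.exp (2 * p * v)), e2]
    ring
  have hint : IntegrableOn (fun r : ℝ => Complex.exp
      (-(p ^ 2 * (r : ℂ) ^ 2 + (v : ℂ) ^ 2 / (r : ℂ) ^ 2))) (Ioi 0) := by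
    refine Integrable.mono' ((integrable_exp_neg_mul_sq hsq).integrableOn (s := Ioi 0)) ?_ ?_
    · refine ContinuousOn.aestronglyMeasurable ?_ measurableSet_Ioi
      refine ContinuousOn.cexp (ContinuousOn.neg (ContinuousOn.add (by fun_prop)
        (ContinuousOn.div (by fun_prop) (by fun_prop) ?_)))
      intro r hr
      exact pow_ne_zero _ (by exact_mod_cast (ne_of_gt hr))
    · refine Eventually.of_forall fun r => ?_
      rw [Complex.norm_exp, Real.exp_le_exp]
      rw [← Complex.ofReal_pow, ← Complex.ofReal_pow, ← Complex.ofReal_div, Complex.neg_re,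
        Complex.add_re, Complex.re_mul_ofReal, Complex.ofReal_re]
      have : 0 ≤ v ^ 2 / r ^ 2 := by positivity
      linarith
  have hvr : Tendsto (fun r : ℝ => (v : ℂ) / r) atTop (𝓝 0) := by
    have : Tendsto (fun r : ℝ => ((v / r : ℝ) : ℂ)) atTop (𝓝 ((0 : ℝ) : ℂ)) :=
      (Complex.continuous_ofReal.tendsto 0).comp (tendsto_id.const_div_atTop v)
    simpa using this
  have hpr : Tendsto (fun r : ℝ => p * (r : ℂ)) (𝓝[>] 0) (𝓝 0) := by
    have : Continuous fun r : ℝ => p * (r : ℂ) := by fun_prop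
    simpa using (this.tendsto 0).mono_left nhdsWithin_le_nhds
  have hpt := tendsto_gaussianPrimitive_mul_atTop hE hodd hp
  have hpS : ∀ r : ℝ, 0 ≤ r → |(p * r : ℂ).im| ≤ (p * r : ℂ).re := fun r hr => by
    rw [him, hre', abs_mul, abs_of_nonneg hr]
    gcongr
  have hvS : ∀ r : ℝ, 0 ≤ r → |((v : ℂ) / r).im| ≤ ((v : ℂ) / r).re := fun r hr => by
    rw [hvim, hvre, abs_zero]
    positivity
  have hsumS : ∀ r : ℝ, 0 ≤ r → |(p * r + v / r : ℂ).im| ≤ (p * r + v / r : ℂ).re := fun r hr => by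
    have h1 := hpS r hr
    have h2 := hvS r hr
    rw [Complex.add_im, Complex.add_re]
    exact (abs_add_le _ _).trans (add_le_add h1 h2)
  have t1 : Tendsto (fun r : ℝ => E (p * r + v / r)) atTop (𝓝 G) := by
    refine tendsto_gaussianPrimitive_of_sub_tendsto_zero hE ?_ ?_ ?_ hpt
    · filter_upwards [eventually_ge_atTop 0] with r hr using hsumS r hr
    · filter_upwards [eventually_ge_atTop 0] with r hr using hpS r hr
    · simpa using hvr
  have t2 : Tendsto (fun r : ℝ => E (p * r - v / r)) atTop (𝓝 G) := by
    refine tendsto_gaussianPrimitive_of_sub_tendsto_zero hE ?_ ?_ ?_ hpt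
    · have hpos : 0 < p.re - |p.im| := sub_pos.2 hp
      filter_upwards [eventually_ge_atTop (max 1 (v / (p.re - |p.im|)))] with r hr
      have h1 : 1 ≤ r := (le_max_left _ _).trans hr
      have h2 : v ≤ r * (p.re - |p.im|) := (div_le_iff₀ hpos).1 ((le_max_right _ _).trans hr)
      have h3 : v / r ≤ v := div_le_self hv.le h1
      rw [Complex.sub_im, Complex.sub_re, him, hre', hvim, hvre, sub_zero, abs_mul,
        abs_of_nonneg (zero_le_one.trans h1)]
      nlinarith
    · filter_upwards [eventually_ge_atTop 0] with r hr using hpS r hr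
    · simpa using hvr.neg
  have hinv : Tendsto (fun r : ℝ => E (v / r)) (𝓝[>] 0) (𝓝 G) := by
    have h1 := tendsto_gaussianPrimitive_mul_atTop hE hodd (p := 1) (by simp)
    have h2 : Tendsto (fun r : ℝ => v * r⁻¹) (𝓝[>] 0) atTop :=
      tendsto_inv_nhdsGT_zero.const_mul_atTop hv
    refine (h1.comp h2).congr fun r => ?_
    simp [div_eq_mul_inv]
  have t3 : Tendsto (fun r : ℝ => E (p * r + v / r)) (𝓝[>] 0) (𝓝 G) := by
    refine tendsto_gaussianPrimitive_of_sub_tendsto_zero hE ?_ ?_ ?_ hinv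
    · filter_upwards [self_mem_nhdsWithin] with r hr using hsumS r (le_of_lt hr)
    · filter_upwards [self_mem_nhdsWithin] with r hr using hvS r (le_of_lt hr)
    · simpa using hpr
  have t4 : Tendsto (fun r : ℝ => E (p * r - v / r)) (𝓝[>] 0) (𝓝 (-G)) := by
    have : Tendsto (fun r : ℝ => E (v / r - p * r)) (𝓝[>] 0) (𝓝 G) := by
      refine tendsto_gaussianPrimitive_of_sub_tendsto_zero hE ?_ ?_ ?_ hinv
      · have hlim : Tendsto (fun r : ℝ => (p.re + |p.im|) * r ^ 2) (𝓝[>] 0) (𝓝 0) := by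
          have : Continuous fun r : ℝ => (p.re + |p.im|) * r ^ 2 := by fun_prop
          simpa using (this.tendsto 0).mono_left nhdsWithin_le_nhds
        filter_upwards [self_mem_nhdsWithin, hlim.eventually (Iic_mem_nhds hv)] with r hr h
        have hr' : 0 < r := hr
        have h2 : (p.re + |p.im|) * r ≤ v / r := by
          rw [le_div_iff₀ hr']
          calc _ = (p.re + |p.im|) * r ^ 2 := by ring
            _ ≤ v := h
        rw [Complex.sub_im, Complex.sub_re, him, hre', hvim, hvre, zero_sub, abs_neg, abs_mul,
          abs_of_pos hr']
        linarith
      · filter_upwards [self_mem_nhdsWithin] with r hr using hvS r (le_of_lt hr)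
      · simpa using hpr.neg
    refine this.neg.congr fun r => ?_
    rw [← hodd, neg_sub]
  have hWtop := (t2.const_mul (Complex.exp (-(2 * p * v)))).add
    (t1.const_mul (Complex.exp (2 * p * v)))
  have hWzero := (t4.const_mul (Complex.exp (-(2 * p * v)))).add
    (t3.const_mul (Complex.exp (2 * p * v)))
  have key := integral_Ioi_of_hasDerivAt_of_tendsto
    (f := Function.update W 0 (Complex.exp (-(2 * p * v)) * -G + Complex.exp (2 * p * v) * G))
    (a := 0) (f' := fun r : ℝ => 2 * p * Complex.exp
      (-(p ^ 2 * (r : ℂ) ^ 2 + (v : ℂ) ^ 2 / (r : ℂ) ^ 2))) ?_ ?_ (hint.const_mul _)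
    (hWtop.congr' ?_)
  · rw [integral_const_mul, Function.update_self] at key
    refine mul_left_cancel₀ (mul_ne_zero two_ne_zero hp0) (key.trans ?_)
    rw [hGdef]
    push_cast
    field_simp
    ring
  · rw [continuousWithinAt_update_same, Ici_sdiff_left]
    exact hWzero
  · intro r hr
    refine (hderiv r hr).congr_of_eventuallyEq ?_
    filter_upwards [Ioi_mem_nhds hr] with x hx
    exact Function.update_of_ne (ne_of_gt hx) _ _
  · filter_upwards [eventually_gt_atTop 0] with x hx
    rw [Function.update_of_ne hx.ne']

/-- The Laplace transform of `s ^ (-3/2) exp (-p² / s)`. -/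
theorem laplace_invSqrtExt_powGauss {p : ℂ} (hp : |p.im| < p.re) {v : ℝ} (hv : 0 < v) :
    ∫ s : ℝ in Ioi 0, (Real.exp (-(s * v ^ 2)) : ℂ) * invSqrtExt (powGauss 0 (p ^ 2) 3) s =
      (√Real.pi : ℝ) / p * Complex.exp (-(2 * p * v)) := by
  have hp0 : p ≠ 0 := fun h => by simp [h] at hp
  have h := integral_comp_rpow_Ioi (fun r : ℝ => 2 * Complex.exp
    (-(p ^ 2 * (r : ℂ) ^ 2 + (v : ℂ) ^ 2 / (r : ℂ) ^ 2))) (p := -(1 / 2)) (by norm_num)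
  rw [integral_const_mul, integral_exp_neg_sq_add_inv_sq hp hv] at h
  rw [show ((√Real.pi : ℝ) : ℂ) / p * Complex.exp (-(2 * p * v)) =
    2 * ((√Real.pi : ℝ) / (2 * p) * Complex.exp (-(2 * p * v))) by field_simp, ← h]
  refine setIntegral_congr_fun measurableSet_Ioi fun s hs => ?_
  have hs' : 0 < s := hs
  have hq : 0 < √s := Real.sqrt_pos.2 hs'
  have e1 : s ^ (-(1 / 2) : ℝ) = (√s)⁻¹ := by
    rw [Real.rpow_neg hs'.le, Real.sqrt_eq_rpow]
  have e2 : s ^ (-(1 / 2) - 1 : ℝ) = (√s)⁻¹ ^ 3 := by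
    rw [← e1, ← Real.rpow_natCast, ← Real.rpow_mul hs'.le]
    norm_num
  have e3 : (s : ℂ) = ((√s : ℝ) : ℂ) ^ 2 := by
    rw [← Complex.ofReal_pow, Real.sq_sqrt hs'.le]
  have hqc : ((√s : ℝ) : ℂ) ≠ 0 := by exact_mod_cast hq.ne'
  rw [invSqrtExt_of_pos _ hs', e1, e2, powGauss, Complex.real_smul, Complex.ofReal_exp,
    show |(-(1 / 2) : ℝ)| = 1 / 2 by norm_num]
  rw [mul_left_comm, ← Complex.exp_add]
  have e4 : ∀ X Y : ℂ, X = Y → ((((√s)⁻¹ : ℝ) : ℂ)) ^ 3 * Complex.exp X =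
      ((1 / 2 * (√s)⁻¹ ^ 3 : ℝ) : ℂ) * (2 * Complex.exp Y) := by
    rintro X _ rfl
    push_cast
    ring
  refine e4 _ _ ?_
  push_cast
  rw [e3]
  field_simp
  ring

theorem integrableOn_pow_mul_exp_neg_mul (m : ℕ) {b : ℝ} (hb : 0 < b) :
    IntegrableOn (fun s : ℝ => s ^ m * Real.exp (-(s * b))) (Ioi 0) := by
  have h := integrableOn_rpow_mul_exp_neg_mul_rpow (p := 1) (s := m) (b := b)
    (by linarith [(Nat.cast_nonneg m : (0 : ℝ) ≤ m)]) one_pos hb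
  refine h.congr_fun (fun s _ => ?_) measurableSet_Ioi
  simp only [Real.rpow_natCast, Real.rpow_one]
  ring_nf

/-- The `m`-th moment of `exp (-s u²) ψ(s)`. -/
noncomputable def laplaceMoment (ψ : ℝ → ℂ) (m : ℕ) (u : ℝ) : ℂ :=
  ∫ s : ℝ in Ioi 0, ((s ^ m * Real.exp (-(s * u ^ 2)) : ℝ) : ℂ) * ψ s

theorem integrableOn_laplaceMoment {ψ : ℝ → ℂ} (hψ : Continuous ψ) {C : ℝ}
    (hC : ∀ s, ‖ψ s‖ ≤ C) (m : ℕ) {u : ℝ} (hu : 0 < u) :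
    IntegrableOn (fun s : ℝ => ((s ^ m * Real.exp (-(s * u ^ 2)) : ℝ) : ℂ) * ψ s) (Ioi 0) := by
  refine ((integrableOn_pow_mul_exp_neg_mul m (pow_pos hu 2)).ofReal).mul_bdd (c := C)
    hψ.aestronglyMeasurable (Eventually.of_forall hC)

theorem hasDerivAt_laplaceMoment {ψ : ℝ → ℂ} (hψ : Continuous ψ) {C : ℝ}
    (hC : ∀ s, ‖ψ s‖ ≤ C) (m : ℕ) {u : ℝ} (hu : 0 < u) :
    HasDerivAt (laplaceMoment ψ m) (-2 * u * laplaceMoment ψ (m + 1) u) u := by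
  have key := hasDerivAt_integral_of_dominated_loc_of_deriv_le
    (μ := volume.restrict (Ioi (0 : ℝ))) (𝕜 := ℝ)
    (F := fun (u s : ℝ) => ((s ^ m * Real.exp (-(s * u ^ 2)) : ℝ) : ℂ) * ψ s)
    (F' := fun (u s : ℝ) => (((-2 * u) * (s ^ (m + 1) * Real.exp (-(s * u ^ 2))) : ℝ) : ℂ) * ψ s)
    (x₀ := u) (s := Ioo (u / 2) (2 * u))
    (bound := fun s => 2 * (2 * u) * (s ^ (m + 1) * Real.exp (-(s * (u / 2) ^ 2))) * C)
    (Ioo_mem_nhds (by linarith) (by linarith)) ?_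
    (integrableOn_laplaceMoment hψ hC m hu) ?_ ?_ ?_ ?_
  · refine key.2.congr_deriv ?_
    rw [laplaceMoment, ← integral_const_mul]
    congr 1
    ext s
    push_cast
    ring
  · refine Eventually.of_forall fun x => ?_
    have : Continuous fun s : ℝ => ((s ^ m * Real.exp (-(s * x ^ 2)) : ℝ) : ℂ) * ψ s := by fun_prop
    exact this.aestronglyMeasurable
  · have : Continuous fun s : ℝ =>
      (((-2 * u) * (s ^ (m + 1) * Real.exp (-(s * u ^ 2))) : ℝ) : ℂ) * ψ s := by fun_prop
    exact this.aestronglyMeasurable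
  · filter_upwards [ae_restrict_mem measurableSet_Ioi] with s hs x hx
    have hs' : 0 < s := hs
    have hx0 : u / 2 < x := hx.1
    have hx1 : 0 < x := by linarith
    have hx2 : x < 2 * u := hx.2
    rw [norm_mul, Complex.norm_real, Real.norm_eq_abs, abs_mul, abs_mul,
      abs_of_nonneg (mul_nonneg (pow_nonneg hs'.le _) (Real.exp_pos _).le), abs_of_pos hx1,
      abs_neg, abs_two]
    gcongr
    exact hC s
  · exact (((integrableOn_pow_mul_exp_neg_mul (m + 1) (b := (u / 2) ^ 2)
      (by positivity)).const_mul (2 * (2 * u))).mul_const C)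
  · refine Eventually.of_forall fun s x _ => ?_
    have h1 : HasDerivAt (fun u : ℝ => s ^ m * Real.exp (-(s * u ^ 2)))
        ((-2 * x) * (s ^ (m + 1) * Real.exp (-(s * x ^ 2)))) x := by
      refine ((((hasDerivAt_pow 2 x).const_mul s).fun_neg.exp).const_mul (s ^ m)).congr_deriv ?_
      push_cast
      ring
    exact h1.ofReal_comp.mul_const (ψ s)

theorem norm_laplaceMoment_le {ψ : ℝ → ℂ} {C ε : ℝ} (hC : ∀ s, ‖ψ s‖ ≤ C)
    (hε : ∀ s ≤ ε, ψ s = 0) (m : ℕ) {u : ℝ} (hu : 1 ≤ u) :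
    ‖laplaceMoment ψ m u‖ ≤
      Real.exp (-(ε * (u ^ 2 - 1))) * (C * ∫ s : ℝ in Ioi 0, s ^ m * Real.exp (-(s * 1))) := by
  have hC0 : 0 ≤ C := (norm_nonneg _).trans (hC 0)
  rw [← integral_const_mul, ← integral_const_mul]
  refine norm_integral_le_of_norm_le
    (((integrableOn_pow_mul_exp_neg_mul m one_pos).const_mul C).const_mul _) ?_
  filter_upwards [ae_restrict_mem measurableSet_Ioi] with s hs
  have hs' : 0 < s := hs
  rw [norm_mul, Complex.norm_real, Real.norm_eq_abs,
    abs_of_nonneg (mul_nonneg (pow_nonneg hs'.le _) (Real.exp_pos _).le)]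
  rcases le_or_gt s ε with h | h
  · rw [hε s h, norm_zero, mul_zero]
    positivity
  · have h1 : Real.exp (-(s * u ^ 2)) ≤ Real.exp (-(ε * (u ^ 2 - 1))) * Real.exp (-(s * 1)) := by
      rw [← Real.exp_add, Real.exp_le_exp]
      nlinarith [mul_nonneg (sub_nonneg.2 h.le) (by nlinarith : 0 ≤ u ^ 2 - 1)]
    calc s ^ m * Real.exp (-(s * u ^ 2)) * ‖ψ s‖
        ≤ s ^ m * (Real.exp (-(ε * (u ^ 2 - 1))) * Real.exp (-(s * 1))) * C := by
          gcongr
          exact hC s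
      _ = _ := by ring

/-- If `ψ` vanishes near `0`, the Laplace transform of `ψ` at `1 / x`, multiplied by any
`exp (A / √x)`, extends by zero to a smooth function of `x`. -/
theorem contDiff_invSqrtExt_exp_mul_laplaceMoment {ψ : ℝ → ℂ} (hψ : Continuous ψ) {C ε : ℝ}
    (hC : ∀ s, ‖ψ s‖ ≤ C) (hε0 : 0 < ε) (hε : ∀ s ≤ ε, ψ s = 0) (A : ℝ) :
    ContDiff ℝ ∞ (invSqrtExt fun u => Complex.exp (A * u) * laplaceMoment ψ 0 u) := by
  set f : ℕ × ℕ → ℝ → ℂ := fun i u =>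
    (u : ℂ) ^ i.1 * (Complex.exp (A * u) * laplaceMoment ψ i.2 u) with hf
  have hm : ∀ k, f k ∈ Submodule.span ℂ (range f) := fun k => Submodule.subset_span (mem_range_self k)
  refine contDiff_invSqrtExt (B := range f) ?_ ?_ ?_
  · rintro _ ⟨⟨n, m⟩, rfl⟩
    rw [tendsto_zero_iff_norm_tendsto_zero]
    set K := C * ∫ s : ℝ in Ioi 0, s ^ m * Real.exp (-(s * 1)) with hK
    have h1 := (tendsto_zero_iff_norm_tendsto_zero.1 (tendsto_powGauss_quadratic (w := -A) (z := ε)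
      (by simpa using hε0) (n + 2))).mul_const (Real.exp ε * K)
    rw [zero_mul] at h1
    refine squeeze_zero' (Eventually.of_forall fun u => norm_nonneg _) ?_ h1
    filter_upwards [eventually_ge_atTop 1] with u hu
    have h2 := norm_laplaceMoment_le hC hε m hu
    rw [norm_powGauss]
    simp only [hf, norm_mul, norm_pow, Complex.norm_real, Real.norm_eq_abs, Complex.norm_exp,
      Complex.re_ofReal_mul, Complex.ofReal_re, Complex.neg_re]
    calc |u| ^ 2 * (|u| ^ n * (Real.exp (A * u) * ‖laplaceMoment ψ m u‖))
        ≤ |u| ^ 2 * (|u| ^ n * (Real.exp (A * u) * (Real.exp (-(ε * (u ^ 2 - 1))) * K))) := by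
          gcongr
      _ = |u| ^ (n + 2) * (Real.exp (A * u) * Real.exp (-(ε * (u ^ 2 - 1)))) * K := by ring
      _ = |u| ^ (n + 2) * (Real.exp (-(-A * u + ε * u ^ 2)) * Real.exp ε) * K := by
          rw [← Real.exp_add, ← Real.exp_add]
          ring_nf
      _ = _ := by ring
  · rintro _ ⟨⟨n, m⟩, rfl⟩
    refine ⟨(-(n : ℂ) / 2) • f (n + 2, m) + ((-(A : ℂ) / 2) • f (n + 3, m) + f (n + 4, m + 1)),
      add_mem (Submodule.smul_mem _ _ (hm _)) (add_mem (Submodule.smul_mem _ _ (hm _)) (hm _)),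
      fun u hu => ?_⟩
    have h0 : HasDerivAt (fun u : ℝ => (u : ℂ)) 1 u := Complex.ofRealCLM.hasDerivAt
    have hu' : (u : ℂ) ≠ 0 := by exact_mod_cast hu.ne'
    refine ((h0.fun_pow n).fun_mul (((h0.const_mul (A : ℂ)).cexp).fun_mul
      (hasDerivAt_laplaceMoment hψ hC m hu))).congr_deriv ?_
    simp only [hf, Pi.add_apply, Pi.smul_apply, smul_eq_mul]
    rcases n with _ | n
    · simp
      field_simp
      ring
    · simp
      field_simp
      ring
  · convert hm (0, 0) using 1
    ext u
    simp [hf]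

theorem norm_invSqrtExt_powGauss_three_le {z : ℂ} (hz : 1 ≤ z.re) (s : ℝ) :
    ‖invSqrtExt (powGauss 0 z 3) s‖ ≤ 1 := by
  rcases le_or_gt s 0 with h | h
  · rw [invSqrtExt_of_nonpos _ h, norm_zero]
    exact zero_le_one
  · have hu : 0 < (√s)⁻¹ := inv_pos.2 (Real.sqrt_pos.2 h)
    rw [invSqrtExt_of_pos _ h, norm_powGauss, abs_of_pos hu]
    set u := (√s)⁻¹
    have h1 : u ^ 3 ≤ Real.exp (u ^ 2) := by
      have := Real.quadratic_le_exp_of_nonneg (sq_nonneg u)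
      nlinarith [sq_nonneg (u * (u - 2)), sq_nonneg u]
    have h2 : Real.exp (-((0 : ℂ).re * u + z.re * u ^ 2)) ≤ Real.exp (-(u ^ 2)) := by
      rw [Real.exp_le_exp, Complex.zero_re]
      nlinarith [sq_nonneg u]
    calc u ^ 3 * Real.exp (-((0 : ℂ).re * u + z.re * u ^ 2))
        ≤ Real.exp (u ^ 2) * Real.exp (-(u ^ 2)) := by gcongr
      _ = 1 := by rw [← Real.exp_add]; simp

theorem norm_invSqrtExt_powGauss_zero_le {z : ℂ} (hz : 0 ≤ z.re) (s : ℝ) :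
    ‖invSqrtExt (powGauss 0 z 0) s‖ ≤ 1 := by
  rcases le_or_gt s 0 with h | h
  · rw [invSqrtExt_of_nonpos _ h, norm_zero]
    exact zero_le_one
  · rw [invSqrtExt_of_pos _ h, norm_powGauss, pow_zero, one_mul, Real.exp_le_one_iff,
      Complex.zero_re]
    nlinarith [mul_nonneg hz (sq_nonneg (√s)⁻¹)]

theorem exists_laplace_cutoff {p : ℂ} (hp : |p.im| < p.re) (hp1 : 1 ≤ (p ^ 2).re) (A : ℝ)
    {χ : ℝ → ℝ} (hχ : Continuous χ) (hχ01 : ∀ s, χ s ∈ Icc (0 : ℝ) 1)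
    (hχ1 : ∀ s ≤ 1 / 6, χ s = 1) (hχ0 : ∀ s, 1 / 4 ≤ s → χ s = 0) :
    ∃ T : ℝ → ℂ, ContDiff ℝ ∞ T ∧ T 0 = 0 ∧ ∀ x : ℝ, 0 < x →
      Complex.exp (A * (√x)⁻¹) * ∫ s in (0 : ℝ)..1, (Real.exp (-s / x) : ℂ) *
        (χ s * invSqrtExt (powGauss 0 (p ^ 2) 3) s) =
      (√Real.pi : ℝ) / p * Complex.exp (-((2 * p - A) * (√x)⁻¹)) - T x := by
  set b := invSqrtExt (powGauss 0 (p ^ 2) 3) with hb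
  have hbc : Continuous b := (contDiff_invSqrtExt_powGauss
    (fun n => tendsto_powGauss_quadratic (by linarith) n) 3).continuous
  have hb1 : ∀ s, ‖b s‖ ≤ 1 := norm_invSqrtExt_powGauss_three_le hp1
  set ψ : ℝ → ℂ := fun s => (1 - χ s : ℝ) * b s with hψ
  have hψc : Continuous ψ := by fun_prop
  have hψ1 : ∀ s, ‖ψ s‖ ≤ 1 := fun s => by
    rw [hψ, norm_mul, Complex.norm_real, Real.norm_eq_abs]
    refine mul_le_one₀ ?_ (norm_nonneg _) (hb1 s)
    rw [abs_le]
    constructor <;> linarith [(hχ01 s).1, (hχ01 s).2]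
  have hχb : ∀ s, ‖(χ s : ℂ) * b s‖ ≤ 1 := fun s => by
    rw [norm_mul, Complex.norm_real, Real.norm_eq_abs]
    refine mul_le_one₀ ?_ (norm_nonneg _) (hb1 s)
    rw [abs_le]
    constructor <;> linarith [(hχ01 s).1, (hχ01 s).2]
  have hψ0 : ∀ s ≤ 1 / 6, ψ s = 0 := fun s hs => by simp [hψ, hχ1 s hs]
  refine ⟨_, contDiff_invSqrtExt_exp_mul_laplaceMoment hψc hψ1 (by norm_num) hψ0 A,
    invSqrtExt_of_nonpos _ le_rfl, fun x hx => ?_⟩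
  rw [invSqrtExt_of_pos _ hx]
  have hu : 0 < (√x)⁻¹ := inv_pos.2 (Real.sqrt_pos.2 hx)
  have hu2 : ((√x)⁻¹) ^ 2 = x⁻¹ := by rw [inv_pow, Real.sq_sqrt hx.le]
  have hL := laplace_invSqrtExt_powGauss hp hu
  set u := (√x)⁻¹
  have hχint := integrableOn_laplaceMoment (ψ := fun s => χ s * b s) (by fun_prop) hχb 0 hu
  have hψint := integrableOn_laplaceMoment hψc hψ1 0 hu
  have hsplit : ∫ s : ℝ in Ioi 0, (Real.exp (-(s * u ^ 2)) : ℂ) * b s =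
      laplaceMoment (fun s => χ s * b s) 0 u + laplaceMoment ψ 0 u := by
    rw [laplaceMoment, laplaceMoment, ← integral_add hχint hψint]
    congr 1
    ext s
    simp only [hψ]
    push_cast
    ring
  have hfin : laplaceMoment (fun s => χ s * b s) 0 u =
      ∫ s in (0 : ℝ)..1, (Real.exp (-s / x) : ℂ) * (χ s * b s) := by
    rw [intervalIntegral.integral_of_le zero_le_one, laplaceMoment]
    rw [setIntegral_eq_of_subset_of_forall_sdiff_eq_zero measurableSet_Ioi
      (Ioc_subset_Ioi_self : Ioc (0 : ℝ) 1 ⊆ Ioi 0)]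
    · refine setIntegral_congr_fun measurableSet_Ioc fun s _ => ?_
      simp only [hu2, pow_zero, one_mul]
      congr 4
      ring
    · intro s hs
      have : 1 < s := by
        by_contra h
        exact hs.2 ⟨hs.1, not_lt.1 h⟩
      simp [hχ0 s (by linarith)]
  rw [← hfin, eq_sub_of_add_eq hsplit.symm, hL, mul_sub, mul_left_comm, ← Complex.exp_add]
  congr 3
  ring

theorem re_powGauss_mul_re_powGauss {κ μ ν : ℝ} (n : ℕ) (s : ℝ) :
    (invSqrtExt (powGauss 0 (μ + ν * Complex.I) n) s).re *
        (invSqrtExt (powGauss 0 (κ + ν * Complex.I) 0) s).re =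
      (1 / 2) * ((invSqrtExt (powGauss 0 (μ + κ : ℝ) n) s).re +
        (invSqrtExt (powGauss 0 ((μ + κ : ℝ) + (2 * ν : ℝ) * Complex.I) n) s).re) := by
  rcases le_or_gt s 0 with h | h
  · simp [invSqrtExt_of_nonpos _ h]
  · simp only [invSqrtExt_of_pos _ h, powGauss]
    set u := (√s)⁻¹
    rw [← Complex.ofReal_pow, ← Complex.ofReal_pow, ← Complex.ofReal_pow, pow_zero,
      Complex.ofReal_one, one_mul, Complex.re_ofReal_mul, Complex.re_ofReal_mul,
      Complex.re_ofReal_mul]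
    simp only [Complex.exp_re, zero_mul, zero_add, Complex.neg_re, Complex.neg_im,
      Complex.add_re, Complex.add_im,
      Complex.ofReal_re, Complex.ofReal_im, Complex.I_re, Complex.I_im, mul_zero, mul_one,
      Complex.mul_re, Complex.mul_im, sub_zero, add_zero, Real.cos_neg, Real.cos_zero]
    have h1 : Real.exp (-((μ + κ) * u ^ 2)) = Real.exp (-(μ * u ^ 2)) * Real.exp (-(κ * u ^ 2)) := by
      rw [← Real.exp_add]
      ring_nf
    have h2 : Real.cos (2 * ν * u ^ 2) = 2 * Real.cos (ν * u ^ 2) ^ 2 - 1 := by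
      rw [← Real.cos_two_mul]
      ring_nf
    rw [h1, h2]
    ring

/-- A smooth cutoff, equal to `1` up to `1/6` and to `0` from `1/4` on. -/
noncomputable def sixthCutoff (s : ℝ) : ℝ := Real.smoothTransition (3 - 12 * s)

theorem contDiff_sixthCutoff : ContDiff ℝ ∞ sixthCutoff :=
  Real.smoothTransition.contDiff.comp (by fun_prop)

theorem sixthCutoff_mem_Icc (s : ℝ) : sixthCutoff s ∈ Icc (0 : ℝ) 1 :=
  ⟨Real.smoothTransition.nonneg _, Real.smoothTransition.le_one _⟩

theorem sixthCutoff_eq_one {s : ℝ} (hs : s ≤ 1 / 6) : sixthCutoff s = 1 :=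
  Real.smoothTransition.one_of_one_le (by linarith)

theorem sixthCutoff_eq_zero {s : ℝ} (hs : 1 / 4 ≤ s) : sixthCutoff s = 0 :=
  Real.smoothTransition.zero_of_nonpos (by linarith)

/-- The real part of the cut-off Laplace transform. -/
theorem re_intervalIntegral_exp_mul {χ : ℝ → ℝ} (hχ : Continuous χ) {f : ℝ → ℂ} (hf : Continuous f)
    (A x : ℝ) :
    (Complex.exp (A * (√x)⁻¹) * ∫ s in (0 : ℝ)..1, (Real.exp (-s / x) : ℂ) * (χ s * f s)).re =
      Real.exp (A * (√x)⁻¹) * ∫ s in (0 : ℝ)..1, Real.exp (-s / x) * (χ s * (f s).re) := by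
  have hint : IntervalIntegrable (fun s : ℝ => (Real.exp (-s / x) : ℂ) * (χ s * f s)) volume 0 1 :=
    Continuous.intervalIntegrable (by fun_prop) _ _
  have h := Complex.reCLM.intervalIntegral_comp_comm hint
  rw [← Complex.ofReal_mul, ← Complex.ofReal_exp, Complex.re_ofReal_mul]
  congr 1
  rw [Complex.reCLM_apply] at h
  rw [← h]
  simp [-Complex.ofReal_exp]

theorem exists_laplace_flat_quotient :
    ∃ b k Φ E : ℝ → ℝ, ContDiff ℝ ∞ b ∧ ContDiff ℝ ∞ k ∧ ContDiff ℝ ∞ Φ ∧ ContDiff ℝ ∞ E ∧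
      (∀ s ≤ 0, b s = 0) ∧ (∀ s, 1 / 4 ≤ s → b s = 0) ∧ (∀ s, 1 / 4 ≤ s → k s = 0) ∧
      (∀ s, |k s| ≤ 1) ∧ (∃ s ∈ Ico (0 : ℝ) (1 / 3), b s ≠ 0) ∧ Φ 0 = 0 ∧ 0 < E 0 ∧
      ∀ x : ℝ, 0 < x → ∃ w : ℝ, Φ x = w * ∫ s in (0 : ℝ)..1, Real.exp (-s / x) * b s ∧
        E x = w * ∫ s in (0 : ℝ)..1, Real.exp (-s / x) * (k s * b s) := by
  set a : ℝ := √(369 / 100) with ha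
  have ha2 : a ^ 2 = 369 / 100 := Real.sq_sqrt (by norm_num)
  have ha0 : 0 < a := Real.sqrt_pos.2 (by norm_num)
  have ha1 : a < 2 := by nlinarith
  set p : ℂ := 2 + Complex.I with hp
  set q : ℂ := 5 / 2 + 8 / 5 * Complex.I with hq
  have hpre : p.re = 2 := by simp [hp]
  have hpim : p.im = 1 := by simp [hp]
  have hqre : q.re = 5 / 2 := by simp [hq]
  have hqim : q.im = 8 / 5 := by simp [hq]
  have hp2 : p ^ 2 = ((3 : ℝ) : ℂ) + ((4 : ℝ) : ℂ) * Complex.I := by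
    rw [hp]
    push_cast
    linear_combination Complex.I_sq
  have hq2 : q ^ 2 = ((3 + 69 / 100 : ℝ) : ℂ) + ((2 * 4 : ℝ) : ℂ) * Complex.I := by
    rw [hq]
    push_cast
    linear_combination (64 / 25) * Complex.I_sq
  have hac : (a : ℂ) ^ 2 = ((3 + 69 / 100 : ℝ) : ℂ) := by
    rw [← Complex.ofReal_pow, ha2]
    norm_num
  have hp2re : (p ^ 2).re = 3 := by rw [hp2]; simp
  have hq2re : (q ^ 2).re = 369 / 100 := by
    rw [hq2, Complex.add_re, Complex.re_ofReal_mul, Complex.I_re, Complex.ofReal_re]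
    norm_num
  have ha2re : ((a : ℂ) ^ 2).re = 369 / 100 := by rw [hac, Complex.ofReal_re]; norm_num
  set κ : ℂ := ((69 / 100 : ℝ) : ℂ) + ((4 : ℝ) : ℂ) * Complex.I with hκ
  have hκre : κ.re = 69 / 100 := by
    rw [hκ, Complex.add_re, Complex.re_ofReal_mul, Complex.I_re, Complex.ofReal_re]
    norm_num
  have hsmooth : ∀ {z : ℂ}, 0 < z.re → ∀ n, ContDiff ℝ ∞ (invSqrtExt (powGauss 0 z n)) :=
    fun hz n => contDiff_invSqrtExt_powGauss (fun n => tendsto_powGauss_quadratic hz n) n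
  have hlin : ∀ {w : ℂ}, 0 < w.re → ContDiff ℝ ∞ (invSqrtExt (powGauss w 0 0)) :=
    fun hw => contDiff_invSqrtExt_powGauss (fun n => tendsto_powGauss_linear hw n) 0
  have hre : ∀ {f : ℝ → ℂ}, ContDiff ℝ ∞ f → ContDiff ℝ ∞ fun s => (f s).re :=
    fun hf => Complex.reCLM.contDiff.comp hf
  have hχc := contDiff_sixthCutoff.continuous
  obtain ⟨T, hT, hT0, hTx⟩ := exists_laplace_cutoff (p := p) (by rw [hpre, hpim]; norm_num)
    (by rw [hp2re]; norm_num) (2 * a) hχc sixthCutoff_mem_Icc (fun s => sixthCutoff_eq_one)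
    (fun s => sixthCutoff_eq_zero)
  have hχ2c : Continuous fun s => sixthCutoff s ^ 2 := hχc.pow 2
  have hχ2 : ∀ s, sixthCutoff s ^ 2 ∈ Icc (0 : ℝ) 1 := fun s =>
    ⟨sq_nonneg _, pow_le_one₀ (sixthCutoff_mem_Icc s).1 (sixthCutoff_mem_Icc s).2⟩
  have hχ21 : ∀ s ≤ (1 / 6 : ℝ), sixthCutoff s ^ 2 = 1 := fun s hs => by
    rw [sixthCutoff_eq_one hs, one_pow]
  have hχ20 : ∀ s, (1 / 4 : ℝ) ≤ s → sixthCutoff s ^ 2 = 0 := fun s hs => by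
    rw [sixthCutoff_eq_zero hs]
    norm_num
  obtain ⟨Ta, hTa, hTa0, hTax⟩ := exists_laplace_cutoff (p := a)
    (by rw [Complex.ofReal_im, Complex.ofReal_re, abs_zero]; exact ha0)
    (by rw [ha2re]; norm_num) (2 * a) hχ2c hχ2 hχ21 hχ20
  obtain ⟨Tq, hTq, hTq0, hTqx⟩ := exists_laplace_cutoff (p := q) (by rw [hqre, hqim]; norm_num [abs_of_pos])
    (by rw [hq2re]; norm_num) (2 * a) hχ2c hχ2 hχ21 hχ20
  have hwp : 0 < (2 * p - (2 * a : ℝ)).re := by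
    rw [Complex.sub_re, Complex.ofReal_re]
    simp only [Complex.mul_re, Complex.re_ofNat, Complex.im_ofNat, zero_mul, sub_zero, hpre]
    linarith
  have hwq : 0 < (2 * q - (2 * a : ℝ)).re := by
    rw [Complex.sub_re, Complex.ofReal_re]
    simp only [Complex.mul_re, Complex.re_ofNat, Complex.im_ofNat, zero_mul, sub_zero, hqre]
    linarith
  set β : ℝ → ℝ := fun s => (invSqrtExt (powGauss 0 (p ^ 2) 3) s).re with hβ
  set k₀ : ℝ → ℝ := fun s => (invSqrtExt (powGauss 0 κ 0) s).re with hk₀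
  have hβs : ContDiff ℝ ∞ β := hre (hsmooth (by rw [hp2re]; norm_num) 3)
  have hk₀s : ContDiff ℝ ∞ k₀ := hre (hsmooth (by rw [hκre]; norm_num) 0)
  set gp := invSqrtExt (powGauss (2 * p - (2 * a : ℝ)) 0 0) with hgp
  set gq := invSqrtExt (powGauss (2 * q - (2 * a : ℝ)) 0 0) with hgq
  refine ⟨fun s => sixthCutoff s * β s, fun s => sixthCutoff s * k₀ s,
    fun x => ((√Real.pi : ℝ) / p * gp x - T x).re,
    fun x => 1 / 2 * (√Real.pi / a - (Ta x).re + ((√Real.pi : ℝ) / q * gq x - Tq x).re),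
    contDiff_sixthCutoff.mul hβs, contDiff_sixthCutoff.mul hk₀s,
    hre ((contDiff_const.mul (hlin hwp)).sub hT),
    contDiff_const.mul ((contDiff_const.sub (hre hTa)).add
      (hre ((contDiff_const.mul (hlin hwq)).sub hTq))), ?_, ?_, ?_, ?_, ?_, ?_, ?_, ?_⟩
  · intro s hs
    simp [hβ, invSqrtExt_of_nonpos _ hs]
  · intro s hs
    simp [sixthCutoff_eq_zero hs]
  · intro s hs
    simp [sixthCutoff_eq_zero hs]
  · intro s
    have h1 : |k₀ s| ≤ 1 := (Complex.abs_re_le_norm _).trans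
      (norm_invSqrtExt_powGauss_zero_le (by rw [hκre]; norm_num) s)
    have h2 := sixthCutoff_mem_Icc s
    rw [abs_mul, abs_of_nonneg h2.1]
    exact mul_le_one₀ h2.2 (abs_nonneg _) h1
  · have hπ := Real.pi_gt_three
    have hs : 0 < (2 * Real.pi)⁻¹ := by positivity
    have hs6 : (2 * Real.pi)⁻¹ ≤ 1 / 6 := by
      rw [one_div]
      exact inv_anti₀ (by norm_num) (by linarith)
    refine ⟨(2 * Real.pi)⁻¹, ⟨hs.le, by linarith⟩, ?_⟩
    have hu2 : (√(2 * Real.pi)⁻¹)⁻¹ ^ 2 = 2 * Real.pi := by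
      rw [inv_pow, Real.sq_sqrt hs.le, inv_inv]
    have hu : 0 < (√(2 * Real.pi)⁻¹)⁻¹ := inv_pos.2 (Real.sqrt_pos.2 hs)
    simp only [sixthCutoff_eq_one hs6, one_mul, hβ, invSqrtExt_of_pos _ hs, powGauss]
    rw [← Complex.ofReal_pow, ← Complex.ofReal_pow, hu2, Complex.re_ofReal_mul, hp2, Complex.exp_re]
    simp only [Complex.neg_im, Complex.add_im, Complex.ofReal_im,
      Complex.mul_im, Complex.I_im, Complex.I_re, Complex.ofReal_re, zero_mul, mul_zero, add_zero,
      zero_add, mul_one, Real.cos_neg]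
    rw [show (4 : ℝ) * (2 * Real.pi) = (4 : ℕ) * (2 * Real.pi) by norm_num,
      Real.cos_nat_mul_two_pi]
    positivity
  · simp [hgp, invSqrtExt_of_nonpos _ le_rfl, hT0]
  · simp only [hgq, invSqrtExt_of_nonpos _ le_rfl, hTq0, hTa0, Complex.zero_re, mul_zero, sub_zero,
      add_zero]
    have := Real.sqrt_pos.2 Real.pi_pos
    positivity
  · intro x hx
    refine ⟨Real.exp (2 * a * (√x)⁻¹), ?_, ?_⟩
    · rw [← re_intervalIntegral_exp_mul hχc (hsmooth (by rw [hp2re]; norm_num) 3).continuous]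
      rw [hTx x hx]
      simp [hgp, invSqrtExt_of_pos _ hx, powGauss]
    · have hterm : ∀ s, sixthCutoff s * k₀ s * (sixthCutoff s * β s) =
          1 / 2 * (sixthCutoff s ^ 2 * (invSqrtExt (powGauss 0 ((a : ℂ) ^ 2) 3) s).re +
            sixthCutoff s ^ 2 * (invSqrtExt (powGauss 0 (q ^ 2) 3) s).re) := by
        intro s
        have h := re_powGauss_mul_re_powGauss (κ := 69 / 100) (μ := 3) (ν := 4) 3 s
        rw [← hp2, ← hκ, ← hq2, ← hac] at h
        calc sixthCutoff s * k₀ s * (sixthCutoff s * β s)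
            = sixthCutoff s ^ 2 * (β s * k₀ s) := by ring
          _ = _ := by rw [h]; ring
      have hac' := (hsmooth (z := (a : ℂ) ^ 2) (by rw [ha2re]; norm_num) 3).continuous
      have hqc' := (hsmooth (z := q ^ 2) (by rw [hq2re]; norm_num) 3).continuous
      have hac'' := Complex.continuous_re.comp hac'
      have hqc'' := Complex.continuous_re.comp hqc'
      have hsum : ∫ s in (0 : ℝ)..1, Real.exp (-s / x) * (sixthCutoff s * k₀ s *
          (sixthCutoff s * β s)) = 1 / 2 * ((∫ s in (0 : ℝ)..1, Real.exp (-s / x) *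
            (sixthCutoff s ^ 2 * (invSqrtExt (powGauss 0 ((a : ℂ) ^ 2) 3) s).re)) +
          ∫ s in (0 : ℝ)..1, Real.exp (-s / x) *
            (sixthCutoff s ^ 2 * (invSqrtExt (powGauss 0 (q ^ 2) 3) s).re)) := by
        rw [← intervalIntegral.integral_add, ← intervalIntegral.integral_const_mul]
        · congr 1
          ext s
          rw [hterm s]
          ring
        · exact Continuous.intervalIntegrable
            (((by fun_prop : Continuous fun s : ℝ => Real.exp (-s / x))).mul (hχ2c.mul hac'')) _ _
        · exact Continuous.intervalIntegrable
            (((by fun_prop : Continuous fun s : ℝ => Real.exp (-s / x))).mul (hχ2c.mul hqc'')) _ _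
      rw [hsum, mul_left_comm, mul_add, ← re_intervalIntegral_exp_mul hχ2c hac',
        ← re_intervalIntegral_exp_mul hχ2c hqc', hTax x hx, hTqx x hx]
      have h1 : ((√Real.pi : ℝ) : ℂ) / a = ((√Real.pi / a : ℝ) : ℂ) := by push_cast; rfl
      simp [hgq, invSqrtExt_of_pos _ hx, powGauss, h1, -Complex.ofReal_div]

theorem exists_positive_weight_laplace_eq_zero :
    ∃ (Q : ℝ → ℝ → ℝ) (b : ℝ → ℝ),
      ContDiff ℝ ∞ (fun p : ℝ × ℝ => Q p.1 p.2) ∧ (∀ s x, 0 < Q s x) ∧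
      (∀ s, 1 / 4 ≤ s → ∀ x, Q s x = 1) ∧ ContDiff ℝ ∞ b ∧ (∀ s ≤ 0, b s = 0) ∧
      (∀ s, 1 / 4 ≤ s → b s = 0) ∧ (∃ s ∈ Ico (0 : ℝ) (1 / 3), b s ≠ 0) ∧
      ∃ δ ∈ Ioc (0 : ℝ) 1, ∀ x ∈ Ioc (0 : ℝ) δ,
        ∫ s in (0 : ℝ)..1, Real.exp (-s / x) * Q s x * b s = 0 := by
  obtain ⟨b, k, Φ, E, hb, hk, hΦ, hE, hb0, hb1, hk1, hkb, hne, hΦ0, hE0, hw⟩ :=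
    exists_laplace_flat_quotient
  have hev : ∀ᶠ x in 𝓝 (0 : ℝ), |Φ x| < E x := by
    refine (hΦ.continuous.abs.tendsto 0).eventually_lt (hE.continuous.tendsto 0) ?_
    rwa [hΦ0, abs_zero]
  obtain ⟨r, hr, hball⟩ := Metric.eventually_nhds_iff_ball.1 hev
  let ζ : ContDiffBump (0 : ℝ) := ⟨r / 2, r, by linarith, by linarith⟩
  have hζ : ContDiff ℝ ∞ ζ := ζ.contDiff
  have hden : ∀ x, |ζ x * Φ x| < ζ x * E x + (1 - ζ x) := by
    intro x
    rcases eq_or_ne (ζ x) 0 with h | h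
    · simp [h]
    · have hx : x ∈ Metric.ball (0 : ℝ) r := by
        have : x ∈ Function.support ζ := h
        rwa [ζ.support_eq] at this
      have h0 : 0 < ζ x := lt_of_le_of_ne ζ.nonneg h.symm
      have h1 : ζ x ≤ 1 := ζ.le_one
      rw [abs_mul, abs_of_pos h0]
      nlinarith [mul_lt_mul_of_pos_left (hball x hx) h0]
  have hden0 : ∀ x, 0 < ζ x * E x + (1 - ζ x) := fun x => (abs_nonneg _).trans_lt (hden x)
  set φ : ℝ → ℝ := fun x => ζ x * Φ x / (ζ x * E x + (1 - ζ x)) with hφ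
  have hφs : ContDiff ℝ ∞ φ :=
    (hζ.mul hΦ).div ((hζ.mul hE).add (contDiff_const.sub hζ)) fun x => (hden0 x).ne'
  have hφ1 : ∀ x, |φ x| < 1 := fun x => by
    rw [hφ, abs_div, abs_of_pos (hden0 x), div_lt_one (hden0 x)]
    exact hden x
  refine ⟨fun s x => 1 - φ x * k s, b,
    contDiff_const.sub ((hφs.comp contDiff_snd).mul (hk.comp contDiff_fst)), fun s x => ?_,
    fun s hs x => by simp [hk1 s hs], hb, hb0, hb1, hne, min (r / 2) 1,
    ⟨lt_min (by linarith) one_pos, min_le_right _ _⟩, fun x hx => ?_⟩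
  · have : |φ x * k s| < 1 := by
      rw [abs_mul]
      exact (mul_le_of_le_one_right (abs_nonneg _) (hkb s)).trans_lt (hφ1 x)
    linarith [le_abs_self (φ x * k s)]
  · have hx0 : 0 < x := hx.1
    have hx2 : x ≤ r / 2 := hx.2.trans (min_le_left _ _)
    have hζ1 : ζ x = 1 := ζ.one_of_mem_closedBall (by
      rw [mem_closedBall_zero_iff, Real.norm_eq_abs, abs_of_pos hx0]
      exact hx2)
    obtain ⟨w, h1, h2⟩ := hw x hx0
    have hE1 : 0 < E x := by simpa [hζ1] using hden0 x
    have hφx : φ x * E x = Φ x := by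
      simp only [hφ, hζ1]
      field_simp
      ring
    have hbc := hb.continuous
    have hkc := hk.continuous
    have hsplit : ∫ s in (0 : ℝ)..1, Real.exp (-s / x) * (1 - φ x * k s) * b s =
        (∫ s in (0 : ℝ)..1, Real.exp (-s / x) * b s) -
          φ x * ∫ s in (0 : ℝ)..1, Real.exp (-s / x) * (k s * b s) := by
      rw [← intervalIntegral.integral_const_mul, ← intervalIntegral.integral_sub]
      · congr 1
        ext s
        ring
      · exact Continuous.intervalIntegrable (by fun_prop) _ _
      · exact Continuous.intervalIntegrable (by fun_prop) _ _
    have hw0 : w ≠ 0 := by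
      rintro rfl
      rw [zero_mul] at h2
      exact hE1.ne' h2
    rw [hsplit]
    refine mul_left_cancel₀ hw0 ?_
    rw [mul_zero, mul_sub, ← h1, mul_left_comm, ← h2, hφx, sub_self]

/-- Mikusiński's moment theorem: bounded exponential moments `∫ exp (n w) g`, `n ≥ 1`, force the
integral of `g` over the sets `{w > τ}`, `τ > 0`, to vanish. -/
theorem setIntegral_eq_zero_of_exp_moments_bounded {X E : Type*} [MeasurableSpace X]
    [NormedAddCommGroup E] [NormedSpace ℝ E] [CompleteSpace E] {μ : Measure X} {w : X → ℝ}
    (hw : Measurable w) {R : ℝ} (hR : ∀ᵐ x ∂μ, w x ≤ R) {g : X → E} (hg : Integrable g μ) {M : ℝ}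
    (hM : ∀ n : ℕ, 1 ≤ n → ‖∫ x, Real.exp (n * w x) • g x ∂μ‖ ≤ M) {τ : ℝ} (hτ : 0 < τ)
    (hnull : μ {x | w x = τ} = 0) : ∫ x in {x | τ < w x}, g x ∂μ = 0 := by
  set y : ℕ → X → ℝ := fun n x => Real.exp (n * (w x - τ)) with hy
  have hym : ∀ n, Measurable (y n) := fun n => by fun_prop
  have hlim : Tendsto (fun n : ℕ => ∫ x, (1 - Real.exp (-y n x)) • g x ∂μ) atTop
      (𝓝 (∫ x, {x | τ < w x}.indicator g x ∂μ)) := by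
    refine tendsto_integral_of_dominated_convergence (fun x => ‖g x‖) (fun n => ?_) hg.norm
      (fun n => Eventually.of_forall fun x => ?_) ?_
    · exact (Measurable.aestronglyMeasurable (by fun_prop)).smul hg.aestronglyMeasurable
    · rw [norm_smul]
      refine mul_le_of_le_one_left (norm_nonneg _) ?_
      have h1 : Real.exp (-y n x) ≤ 1 := Real.exp_le_one_iff.2 (by simp [hy, Real.exp_nonneg])
      have h2 := Real.exp_pos (-y n x)
      rw [Real.norm_eq_abs, abs_le]
      constructor <;> linarith
    · have : ∀ᵐ x ∂μ, w x ≠ τ := by simpa [ae_iff] using hnull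
      filter_upwards [this] with x hx
      rcases lt_or_gt_of_ne hx with h | h
      · have h1 : Tendsto (fun n : ℕ => y n x) atTop (𝓝 0) := by
          refine Real.tendsto_exp_atBot.comp ?_
          exact tendsto_natCast_atTop_atTop.atTop_mul_const_of_neg (sub_neg.2 h)
        have h2 : Tendsto (fun n : ℕ => 1 - Real.exp (-y n x)) atTop (𝓝 (1 - Real.exp (-0))) :=
          tendsto_const_nhds.sub ((Real.continuous_exp.tendsto _).comp h1.neg)
        have h3 := h2.smul_const (g x)
        rw [indicator_of_notMem (by simpa using h.le)]
        simpa using h3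
      · have h1 : Tendsto (fun n : ℕ => y n x) atTop atTop := by
          refine Real.tendsto_exp_atTop.comp ?_
          exact tendsto_natCast_atTop_atTop.atTop_mul_const (sub_pos.2 h)
        have h2 : Tendsto (fun n : ℕ => 1 - Real.exp (-y n x)) atTop (𝓝 (1 - 0)) :=
          tendsto_const_nhds.sub (Real.tendsto_exp_atBot.comp (tendsto_neg_atTop_atBot.comp h1))
        have h3 := h2.smul_const (g x)
        rw [indicator_of_mem (by simpa using h)]
        simpa using h3
  have hbound : ∀ n : ℕ, 1 ≤ n → ‖∫ x, (1 - Real.exp (-y n x)) • g x ∂μ‖ ≤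
      M * (Real.exp (Real.exp (-(n * τ))) - 1) := by
    intro n hn
    have hyR : ∀ᵐ x ∂μ, |y n x| ≤ Real.exp (n * (R - τ)) := by
      filter_upwards [hR] with x hx
      rw [hy, abs_of_pos (Real.exp_pos _)]
      gcongr
    have hFint : ∀ k : ℕ, Integrable (fun x => (((-y n x) ^ k / k.factorial : ℝ)) • g x) μ := by
      intro k
      refine hg.bdd_smul (Real.exp (n * (R - τ)) ^ k / k.factorial)
        (Measurable.aestronglyMeasurable (by fun_prop)) ?_
      filter_upwards [hyR] with x hx
      rw [Real.norm_eq_abs, abs_div, abs_pow, abs_neg, Nat.abs_cast]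
      gcongr
    have hsum := hasSum_integral_of_summable_integral_norm hFint (by
      refine Summable.of_nonneg_of_le (fun k => integral_nonneg fun x => norm_nonneg _) (fun k => ?_)
        ((Real.summable_pow_div_factorial (Real.exp (n * (R - τ)))).mul_right (∫ x, ‖g x‖ ∂μ))
      rw [← integral_const_mul]
      refine integral_mono_ae (hFint k).norm (hg.norm.const_mul _) ?_
      filter_upwards [hyR] with x hx
      rw [norm_smul, Real.norm_eq_abs, abs_div, abs_pow, abs_neg, Nat.abs_cast]
      gcongr)
    have htsum : ∀ x, ∑' k : ℕ, (((-y n x) ^ k / k.factorial : ℝ)) • g x =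
        Real.exp (-y n x) • g x := by
      intro x
      have h := (NormedSpace.expSeries_div_hasSum_exp (𝔸 := ℝ) (-y n x)).smul_const (g x)
      rw [← Real.exp_eq_exp_ℝ] at h
      exact h.tsum_eq
    simp only [htsum] at hsum
    have hexpint : Integrable (fun x => Real.exp (-y n x) • g x) μ := by
      refine hg.bdd_smul 1 (Measurable.aestronglyMeasurable (by fun_prop)) ?_
      refine Eventually.of_forall fun x => ?_
      rw [Real.norm_eq_abs, Real.abs_exp, Real.exp_le_one_iff]
      simp [hy, Real.exp_nonneg]
    have hdiff : ∫ x, (1 - Real.exp (-y n x)) • g x ∂μ =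
        (∫ x, g x ∂μ) - ∫ x, Real.exp (-y n x) • g x ∂μ := by
      rw [← integral_sub hg hexpint]
      simp only [sub_smul, one_smul]
    have hsum1 := (hasSum_nat_add_iff' 1).2 hsum
    simp only [Finset.range_one, Finset.sum_singleton, pow_zero, Nat.factorial_zero, Nat.cast_one,
      div_one, one_smul] at hsum1
    have hexp := ((hasSum_nat_add_iff' 1).2
      (NormedSpace.expSeries_div_hasSum_exp (𝔸 := ℝ) (Real.exp (-(n * τ))))).mul_left M
    rw [← Real.exp_eq_exp_ℝ] at hexp
    simp only [Finset.range_one, Finset.sum_singleton, pow_zero, Nat.factorial_zero, Nat.cast_one,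
      div_one] at hexp
    rw [hdiff, norm_sub_rev]
    rw [← hsum1.tsum_eq]
    refine tsum_of_norm_bounded hexp fun k => ?_
    have hterm : ∫ x, (((-y n x) ^ (k + 1) / (k + 1).factorial : ℝ)) • g x ∂μ =
        ((-1) ^ (k + 1) * (Real.exp (-(n * τ)) ^ (k + 1) / (k + 1).factorial) : ℝ) •
          ∫ x, Real.exp (((n * (k + 1) : ℕ) : ℝ) * w x) • g x ∂μ := by
      rw [← integral_smul]
      congr 1
      ext x
      rw [smul_smul, neg_pow, hy]
      congr 1
      have : Real.exp (n * (w x - τ)) ^ (k + 1) =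
          Real.exp (-(n * τ)) ^ (k + 1) * Real.exp (((n * (k + 1) : ℕ) : ℝ) * w x) := by
        rw [← Real.exp_nat_mul, ← Real.exp_nat_mul, ← Real.exp_add]
        push_cast
        ring_nf
      simp only [this]
      ring
    rw [hterm, norm_smul, norm_mul, norm_pow, norm_neg, norm_one, one_pow, one_mul,
      Real.norm_of_nonneg (by positivity), mul_comm]
    gcongr
    exact hM _ (Nat.one_le_iff_ne_zero.2 (by positivity))
  have hzero : Tendsto (fun n : ℕ => M * (Real.exp (Real.exp (-(n * τ))) - 1)) atTop (𝓝 0) := by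
    have h1 : Tendsto (fun n : ℕ => Real.exp (-(n * τ))) atTop (𝓝 0) :=
      Real.tendsto_exp_atBot.comp (tendsto_neg_atTop_atBot.comp
        (tendsto_natCast_atTop_atTop.atTop_mul_const hτ))
    have h2 := (((Real.continuous_exp.tendsto 0).comp h1).sub_const 1).const_mul M
    simpa using h2
  have := tendsto_nhds_unique hlim (squeeze_zero_norm' (by
    filter_upwards [eventually_ge_atTop 1] with n hn using hbound n hn) hzero)
  rwa [integral_indicator (measurableSet_lt measurable_const hw)] at this

theorem ae_eq_zero_of_forall_intervalIntegral_eq_zero {E : Type*} [NormedAddCommGroup E]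
    [NormedSpace ℝ E] [CompleteSpace E] {k : ℝ → E} (hk : IntervalIntegrable k volume 0 1)
    (h : ∀ v ∈ Icc (0 : ℝ) 1, ∫ t in (0 : ℝ)..v, k t = 0) :
    ∀ᵐ t ∂(volume.restrict (Icc (0 : ℝ) 1)), k t = 0 := by
  rw [← restrict_Ioo_eq_restrict_Icc, ae_restrict_iff' measurableSet_Ioo]
  filter_upwards [hk.ae_hasDerivAt_integral] with x hx hx01
  have h1 := hx (by rw [uIcc_of_le zero_le_one]; exact Ioo_subset_Icc_self hx01) 0
    (by simp)
  have h2 : HasDerivAt (fun v => ∫ t in (0 : ℝ)..v, k t) 0 x := by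
    refine (hasDerivAt_const x (0 : E)).congr_of_eventuallyEq ?_
    filter_upwards [Ioo_mem_nhds hx01.1 hx01.2] with v hv
    exact h v (Ioo_subset_Icc_self hv)
  exact h1.unique h2

/-- An integrable function dominated by a multiple of its own primitive vanishes. -/
theorem ae_eq_zero_of_norm_le_mul_integral_norm {E : Type*} [NormedAddCommGroup E] {a : ℝ → E}
    (ha : Integrable a) {L : ℝ} (hL : 0 ≤ L)
    (h : ∀ᵐ r ∂(volume.restrict (Icc (0 : ℝ) 1)), ‖a r‖ ≤ L * ∫ t in (0 : ℝ)..r, ‖a t‖) :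
    ∀ᵐ r ∂(volume.restrict (Icc (0 : ℝ) 1)), a r = 0 := by
  set g : ℝ → ℝ := fun r => ∫ t in (0 : ℝ)..r, ‖a t‖ with hg
  have hgc : Continuous g := ha.norm.continuous_primitive 0
  set G : ℝ → ℝ := fun r => ∫ t in (0 : ℝ)..r, g t with hG
  have hGd : ∀ r, HasDerivAt G (g r) r := fun r =>
    intervalIntegral.integral_hasDerivAt_right (hgc.intervalIntegrable _ _)
      (hgc.stronglyMeasurableAtFilter _ _) hgc.continuousAt
  have hgG : ∀ r ∈ Icc (0 : ℝ) 1, g r ≤ L * G r := by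
    intro r hr
    rw [hG, ← intervalIntegral.integral_const_mul]
    refine intervalIntegral.integral_mono_ae_restrict hr.1 ha.norm.intervalIntegrable
      ((continuous_const.mul hgc).intervalIntegrable _ _) ?_
    exact ae_restrict_of_ae_restrict_of_subset (Icc_subset_Icc_right hr.2) h
  have hanti : AntitoneOn (fun r => G r * Real.exp (-(L * r))) (Icc 0 1) := by
    have hd : ∀ r, HasDerivAt (fun r => G r * Real.exp (-(L * r)))
        (g r * Real.exp (-(L * r)) + G r * (Real.exp (-(L * r)) * -(L * 1))) r := fun r =>
      (hGd r).mul (((hasDerivAt_id r).const_mul L).neg.exp)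
    refine antitoneOn_of_deriv_nonpos (convex_Icc 0 1)
      (fun r _ => (hd r).continuousAt.continuousWithinAt)
      (fun r _ => (hd r).differentiableAt.differentiableWithinAt) fun r hr => ?_
    rw [(hd r).deriv]
    have := hgG r (interior_subset hr)
    nlinarith [Real.exp_pos (-(L * r))]
  have hG1 : G 1 ≤ 0 := by
    have := hanti (left_mem_Icc.2 zero_le_one) (right_mem_Icc.2 zero_le_one) zero_le_one
    simp only [hG, intervalIntegral.integral_same, zero_mul] at this
    exact nonpos_of_mul_nonpos_left this (Real.exp_pos _)
  have hg1 : g 1 ≤ 0 :=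
    (hgG 1 (right_mem_Icc.2 zero_le_one)).trans (mul_nonpos_of_nonneg_of_nonpos hL hG1)
  have hg0 : ∫ t in Icc (0 : ℝ) 1, ‖a t‖ = 0 := by
    refine le_antisymm ?_ (integral_nonneg fun t => norm_nonneg _)
    rwa [integral_Icc_eq_integral_Ioc, ← intervalIntegral.integral_of_le zero_le_one]
  have := (integral_eq_zero_iff_of_nonneg (fun t => norm_nonneg _) ha.norm.integrableOn).1 hg0
  filter_upwards [this] with r hr using norm_eq_zero.1 hr

section Volterra

variable {𝕜 : Type*} [RCLike 𝕜]

/-- Fubini's theorem on the triangle `0 < t < r ≤ σ`, for a kernel of convolution type. -/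
theorem intervalIntegral_convolution_triangle {a : ℝ → 𝕜} (ha : Integrable a) {f : ℝ → ℝ → 𝕜}
    (hf : Continuous fun p : ℝ × ℝ => f p.1 p.2) {C : ℝ} (hC : ∀ t s, ‖f t s‖ ≤ C) {σ : ℝ}
    (hσ : 0 ≤ σ) :
    IntervalIntegrable (fun r => ∫ t in (0 : ℝ)..r, a t * f t (r - t)) volume 0 σ ∧
      ∫ t in (0 : ℝ)..σ, a t * ∫ s in (0 : ℝ)..(σ - t), f t s =
        ∫ r in (0 : ℝ)..σ, ∫ t in (0 : ℝ)..r, a t * f t (r - t) := by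
  set μ := volume.restrict (Ioc 0 σ) with hμ
  set h : ℝ → ℝ → 𝕜 := fun t r => a t * f t (r - t) with hh
  set H : ℝ × ℝ → 𝕜 := {p : ℝ × ℝ | p.1 < p.2}.indicator fun p => h p.1 p.2 with hH
  have hHint : Integrable H (μ.prod μ) := by
    refine Integrable.indicator ?_ (measurableSet_lt measurable_fst measurable_snd)
    refine Integrable.mul_bdd (c := C) ((ha.restrict (s := Ioc 0 σ)).comp_fst μ) ?_
      (Eventually.of_forall fun p => hC _ _)
    have : Continuous fun p : ℝ × ℝ => f p.1 (p.2 - p.1) :=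
      hf.comp (continuous_fst.prodMk (continuous_snd.sub continuous_fst))
    exact this.aestronglyMeasurable
  have h1 : ∀ r ∈ Ioc 0 σ, ∫ t, H (t, r) ∂μ = ∫ t in (0 : ℝ)..r, h t r := by
    intro r hr
    have : (fun t => H (t, r)) = (Iio r).indicator fun t => h t r := by
      ext t
      simp only [hH, indicator_apply, mem_Iio, mem_ofPred_eq]
    rw [this, integral_indicator measurableSet_Iio, hμ, Measure.restrict_restrict measurableSet_Iio,
      intervalIntegral.integral_of_le hr.1.le, ← integral_Ioc_eq_integral_Ioo.symm]
    congr 2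
    ext t
    simp only [mem_inter_iff, mem_Iio, mem_Ioc, mem_Ioo]
    have := hr.2
    constructor
    · rintro ⟨h1, h2, h3⟩
      exact ⟨h2, h1⟩
    · rintro ⟨h1, h2⟩
      exact ⟨h2, h1, by linarith⟩
  have h2 : ∀ t ∈ Ioc 0 σ, ∫ r, H (t, r) ∂μ = a t * ∫ s in (0 : ℝ)..(σ - t), f t s := by
    intro t ht
    have : (fun r => H (t, r)) = (Ioi t).indicator fun r => h t r := by
      ext r
      simp only [hH, indicator_apply, mem_Ioi, mem_ofPred_eq]
    have hsub := intervalIntegral.integral_comp_sub_right (a := t) (b := σ) (fun s => f t s) t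
    rw [sub_self] at hsub
    rw [this, integral_indicator measurableSet_Ioi, hμ, Measure.restrict_restrict measurableSet_Ioi,
      ← hsub, ← intervalIntegral.integral_const_mul, intervalIntegral.integral_of_le ht.2]
    congr 2
    ext r
    simp only [mem_inter_iff, mem_Ioi, mem_Ioc]
    have := ht.1
    constructor
    · rintro ⟨h1, h2, h3⟩
      exact ⟨h1, h3⟩
    · rintro ⟨h1, h2⟩
      exact ⟨h1, by linarith, h2⟩
  refine ⟨?_, ?_⟩
  · rw [intervalIntegrable_iff_integrableOn_Ioc_of_le hσ]
    exact hHint.integral_prod_right.congr (by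
      filter_upwards [ae_restrict_mem measurableSet_Ioc] with r hr using h1 r hr)
  · rw [intervalIntegral.integral_of_le hσ, intervalIntegral.integral_of_le hσ]
    rw [← setIntegral_congr_fun measurableSet_Ioc h2, ← setIntegral_congr_fun measurableSet_Ioc h1]
    exact integral_integral_swap (f := fun t r => H (t, r)) hHint

/-- Uniqueness for the (integrated) Volterra equation of the first kind
`∫₀ᵛ a(t) c(t, v - t) dt = 0` with nonvanishing diagonal. -/
theorem ae_eq_zero_of_volterra_first_kind {a : ℝ → 𝕜} (ha : Integrable a) {c d : ℝ → ℝ → 𝕜}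
    (hc : Continuous fun p : ℝ × ℝ => c p.1 p.2) (hd : Continuous fun p : ℝ × ℝ => d p.1 p.2)
    {Cc Cd : ℝ} (hCc : ∀ t s, ‖c t s‖ ≤ Cc) (hCd : ∀ t s, ‖d t s‖ ≤ Cd)
    (hcd : ∀ t ∈ Icc (0 : ℝ) 1, ∀ s ∈ Icc (0 : ℝ) 1,
      c t s = c t 0 + ∫ σ in (0 : ℝ)..s, d t σ)
    (hc0 : ∀ t ∈ Icc (0 : ℝ) 1, c t 0 ≠ 0)
    (h : ∀ σ ∈ Icc (0 : ℝ) 1, ∫ t in (0 : ℝ)..σ, a t * ∫ s in (0 : ℝ)..(σ - t), c t s = 0) :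
    ∀ᵐ t ∂(volume.restrict (Icc (0 : ℝ) 1)), a t = 0 := by
  have hc00 : Continuous fun t => c t 0 := hc.comp (continuous_id.prodMk continuous_const)
  have hac : Integrable fun t => a t * c t 0 :=
    ha.mul_bdd hc00.aestronglyMeasurable (Eventually.of_forall fun t => hCc t 0)
  set A : ℝ → 𝕜 := fun v => ∫ t in (0 : ℝ)..v, a t * c t (v - t) with hA
  set D : ℝ → 𝕜 := fun r => ∫ t in (0 : ℝ)..r, a t * d t (r - t) with hD
  set k : ℝ → 𝕜 := fun r => a r * c r 0 + D r with hk
  have hDint : IntervalIntegrable D volume 0 1 :=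
    (intervalIntegral_convolution_triangle ha hd hCd zero_le_one).1
  have hkint : IntervalIntegrable k volume 0 1 := hac.intervalIntegrable.add hDint
  have hAint : IntervalIntegrable A volume 0 1 :=
    (intervalIntegral_convolution_triangle ha hc hCc zero_le_one).1
  have hAk : ∀ v ∈ Icc (0 : ℝ) 1, A v = ∫ r in (0 : ℝ)..v, k r := by
    intro v hv
    have hDv : IntervalIntegrable D volume 0 v := hDint.mono_set (by
      rw [uIcc_of_le hv.1, uIcc_of_le zero_le_one]
      exact Icc_subset_Icc_right hv.2)
    rw [hk, intervalIntegral.integral_add hac.intervalIntegrable hDv, hD,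
      ← (intervalIntegral_convolution_triangle ha hd hCd hv.1).2, hA]
    have hsplit : ∀ t ∈ uIcc 0 v, a t * c t (v - t) =
        a t * c t 0 + a t * ∫ s in (0 : ℝ)..(v - t), d t s := by
      intro t ht
      rw [uIcc_of_le hv.1] at ht
      rw [← mul_add, ← hcd t ⟨ht.1, ht.2.trans hv.2⟩ (v - t)
        ⟨by linarith [ht.2], by linarith [ht.1, hv.2]⟩]
    have hacv : Integrable fun t => a t * c t (v - t) := by
      have : Continuous fun t => c t (v - t) :=
        hc.comp (continuous_id.prodMk (continuous_const.sub continuous_id))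
      exact ha.mul_bdd this.aestronglyMeasurable (Eventually.of_forall fun t => hCc t _)
    have hrest : IntervalIntegrable (fun t => a t * ∫ s in (0 : ℝ)..(v - t), d t s) volume 0 v := by
      refine (hacv.sub hac).intervalIntegrable.congr fun t ht => ?_
      have := hsplit t (uIoc_subset_uIcc ht)
      simp only [Pi.sub_apply, this, add_sub_cancel_left]
    rw [← intervalIntegral.integral_add hac.intervalIntegrable hrest]
    exact intervalIntegral.integral_congr hsplit
  have hA0 : ∀ᵐ t ∂(volume.restrict (Icc (0 : ℝ) 1)), A t = 0 :=
    ae_eq_zero_of_forall_intervalIntegral_eq_zero hAint fun σ hσ => by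
      rw [← (intervalIntegral_convolution_triangle ha hc hCc hσ.1).2]
      exact h σ hσ
  have hK : EqOn (fun v => ∫ r in (0 : ℝ)..v, k r) 0 (Icc 0 1) := by
    refine Measure.eqOn_Icc_of_ae_eq volume zero_ne_one ?_ ?_ continuousOn_const
    · filter_upwards [hA0, ae_restrict_mem measurableSet_Icc] with v h1 h2
      rw [← hAk v h2, h1, Pi.zero_apply]
    · have := intervalIntegral.continuousOn_primitive_interval
        (f := k) (μ := volume) (a := 0) (b := 1) (by
          rw [uIcc_of_le zero_le_one, integrableOn_Icc_iff_integrableOn_Ioc]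
          exact (intervalIntegrable_iff_integrableOn_Ioc_of_le zero_le_one).1 hkint)
      rwa [uIcc_of_le zero_le_one] at this
  have hk0 := ae_eq_zero_of_forall_intervalIntegral_eq_zero hkint fun v hv => hK hv
  obtain ⟨t₀, ht₀, hmin⟩ := isCompact_Icc.exists_isMinOn (nonempty_Icc.2 (zero_le_one' ℝ))
    hc00.norm.continuousOn
  have hm : 0 < ‖c t₀ 0‖ := norm_pos_iff.2 (hc0 t₀ ht₀)
  have hCd0 : 0 ≤ Cd := (norm_nonneg _).trans (hCd 0 0)
  refine ae_eq_zero_of_norm_le_mul_integral_norm ha (L := Cd / ‖c t₀ 0‖) (by positivity) ?_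
  filter_upwards [hk0, ae_restrict_mem measurableSet_Icc] with r h1 hr
  have hDr : ‖D r‖ ≤ Cd * ∫ t in (0 : ℝ)..r, ‖a t‖ := by
    rw [← intervalIntegral.integral_const_mul]
    refine intervalIntegral.norm_integral_le_of_norm_le hr.1 (Eventually.of_forall fun t _ => ?_)
      (ha.norm.const_mul _).intervalIntegrable
    rw [norm_mul, mul_comm]
    gcongr
    exact hCd _ _
  have h2 : ‖a r‖ * ‖c r 0‖ = ‖D r‖ := by
    rw [← norm_mul, eq_neg_of_add_eq_zero_left h1, norm_neg]
  have h3 : ‖c t₀ 0‖ ≤ ‖c r 0‖ := hmin hr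
  rw [div_mul_eq_mul_div, le_div_iff₀ hm]
  calc ‖a r‖ * ‖c t₀ 0‖ ≤ ‖a r‖ * ‖c r 0‖ := by gcongr
    _ ≤ _ := h2.trans_le hDr

theorem setIntegral_add_lt_eq_intervalIntegral {a : ℝ → 𝕜} {c : ℝ → ℝ → 𝕜}
    {σ : ℝ} (hσ : σ ∈ Icc (0 : ℝ) 1)
    (hint : Integrable (fun p : ℝ × ℝ => a p.1 * c p.1 p.2)
      ((volume.restrict (Icc (0 : ℝ) 1)).prod (volume.restrict (Icc (0 : ℝ) 1)))) :
    ∫ p in {p : ℝ × ℝ | p.1 + p.2 < σ}, a p.1 * c p.1 p.2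
        ∂((volume.restrict (Icc (0 : ℝ) 1)).prod (volume.restrict (Icc (0 : ℝ) 1))) =
      ∫ t in (0 : ℝ)..σ, a t * ∫ s in (0 : ℝ)..(σ - t), c t s := by
  have hms : MeasurableSet {p : ℝ × ℝ | p.1 + p.2 < σ} :=
    measurableSet_lt (measurable_fst.add measurable_snd) measurable_const
  rw [← integral_indicator hms, integral_prod _ (hint.indicator hms)]
  have hinner : ∀ t ∈ Icc (0 : ℝ) 1, ∫ s in Icc (0 : ℝ) 1,
      {p : ℝ × ℝ | p.1 + p.2 < σ}.indicator (fun p => a p.1 * c p.1 p.2) (t, s) =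
        (Ico 0 σ).indicator (fun t => a t * ∫ s in (0 : ℝ)..(σ - t), c t s) t := by
    intro t ht
    have : (fun s => {p : ℝ × ℝ | p.1 + p.2 < σ}.indicator (fun p => a p.1 * c p.1 p.2) (t, s)) =
        (Iio (σ - t)).indicator fun s => a t * c t s := by
      ext s
      simp only [indicator_apply, mem_Iio, mem_ofPred_eq, lt_sub_iff_add_lt']
    rw [this, integral_indicator measurableSet_Iio, Measure.restrict_restrict measurableSet_Iio]
    by_cases htσ : t < σ
    · rw [indicator_of_mem (show t ∈ Ico 0 σ from ⟨ht.1, htσ⟩),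
        ← intervalIntegral.integral_const_mul,
        intervalIntegral.integral_of_le (sub_nonneg.2 htσ.le), integral_Ioc_eq_integral_Ioo,
        ← integral_Ico_eq_integral_Ioo]
      congr 2
      ext s
      simp only [mem_inter_iff, mem_Iio, mem_Icc, mem_Ico]
      constructor
      · rintro ⟨h1, h2, h3⟩
        exact ⟨h2, h1⟩
      · rintro ⟨h1, h2⟩
        exact ⟨h2, h1, by linarith [ht.1, hσ.2]⟩
    · rw [indicator_of_notMem (fun h : t ∈ Ico 0 σ => htσ h.2)]
      have : Iio (σ - t) ∩ Icc (0 : ℝ) 1 = ∅ := by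
        ext s
        simp only [mem_inter_iff, mem_Iio, mem_Icc, mem_empty_iff_false, iff_false]
        rintro ⟨h1, h2, -⟩
        linarith
      rw [this, setIntegral_empty]
  rw [setIntegral_congr_fun measurableSet_Icc hinner, integral_indicator measurableSet_Ico,
    Measure.restrict_restrict measurableSet_Ico, intervalIntegral.integral_of_le hσ.1,
    integral_Ioc_eq_integral_Ioo, ← integral_Ico_eq_integral_Ioo]
  congr 2
  exact inter_eq_left.2 (Ico_subset_Icc_self.trans (Icc_subset_Icc_right hσ.2))

end Volterra

section LaplaceWeight

variable {𝕜 : Type*} [RCLike 𝕜]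

/-- Uniqueness for weights of Laplace type, with globally defined continuous bounded data and the
moment bound in its double-integral form. -/
theorem ae_eq_zero_of_laplace_moments_bounded {a : ℝ → 𝕜} (ha : Integrable a) {c d : ℝ → ℝ → 𝕜}
    (hc : Continuous fun p : ℝ × ℝ => c p.1 p.2) (hd : Continuous fun p : ℝ × ℝ => d p.1 p.2)
    {Cc Cd : ℝ} (hCc : ∀ t s, ‖c t s‖ ≤ Cc) (hCd : ∀ t s, ‖d t s‖ ≤ Cd)
    (hcd : ∀ t ∈ Icc (0 : ℝ) 1, ∀ s ∈ Icc (0 : ℝ) 1,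
      c t s = c t 0 + ∫ σ in (0 : ℝ)..s, d t σ)
    (hc0 : ∀ t ∈ Icc (0 : ℝ) 1, c t 0 ≠ 0) {M : ℝ}
    (hM : ∀ n : ℕ, 1 ≤ n → ‖∫ p : ℝ × ℝ, Real.exp (n * (1 - p.1 - p.2)) • (a p.1 * c p.1 p.2)
      ∂((volume.restrict (Icc (0 : ℝ) 1)).prod (volume.restrict (Icc (0 : ℝ) 1)))‖ ≤ M) :
    ∀ᵐ t ∂(volume.restrict (Icc (0 : ℝ) 1)), a t = 0 := by
  set μ := volume.restrict (Icc (0 : ℝ) 1) with hμ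
  have hint : Integrable (fun p : ℝ × ℝ => a p.1 * c p.1 p.2) (μ.prod μ) :=
    Integrable.mul_bdd (c := Cc) ((ha.restrict (s := Icc (0 : ℝ) 1)).comp_fst μ)
      hc.aestronglyMeasurable (Eventually.of_forall fun p => hCc _ _)
  have hR : ∀ᵐ p ∂(μ.prod μ), 1 - p.1 - p.2 ≤ 1 := by
    rw [hμ, Measure.prod_restrict]
    filter_upwards [ae_restrict_mem (measurableSet_Icc.prod measurableSet_Icc)] with p hp
    linarith [hp.1.1, hp.2.1]
  have hlt : ∀ σ ∈ Ico (0 : ℝ) 1,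
      ∫ t in (0 : ℝ)..σ, a t * ∫ s in (0 : ℝ)..(σ - t), c t s = 0 := by
    intro σ hσ
    have hnull : (μ.prod μ) {p : ℝ × ℝ | 1 - p.1 - p.2 = 1 - σ} = 0 := by
      rw [Measure.measure_prod_null (measurableSet_eq_fun (by fun_prop) measurable_const)]
      refine Eventually.of_forall fun t => ?_
      refine measure_mono_null (t := {σ - t}) (fun s hs => ?_) (measure_singleton _)
      have hs' : 1 - t - s = 1 - σ := hs
      rw [mem_singleton_iff]
      linarith
    have h := setIntegral_eq_zero_of_exp_moments_bounded (w := fun p : ℝ × ℝ => 1 - p.1 - p.2)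
      (by fun_prop) hR hint hM (sub_pos.2 hσ.2) hnull
    rw [← setIntegral_add_lt_eq_intervalIntegral ⟨hσ.1, hσ.2.le⟩ hint, ← h]
    congr 2
    ext p
    simp only [mem_ofPred_eq]
    constructor <;> intro h <;> linarith
  refine ae_eq_zero_of_volterra_first_kind ha hc hd hCc hCd hcd hc0 fun σ hσ => ?_
  have htri := fun σ hσ => (intervalIntegral_convolution_triangle ha hc hCc (σ := σ) hσ).2
  rcases hσ.2.lt_or_eq with h | rfl
  · exact hlt σ ⟨hσ.1, h⟩
  · rw [htri 1 zero_le_one]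
    set A : ℝ → 𝕜 := fun r => ∫ t in (0 : ℝ)..r, a t * c t (r - t)
    have hA : IntervalIntegrable A volume 0 1 :=
      (intervalIntegral_convolution_triangle ha hc hCc zero_le_one).1
    have hcont : ContinuousWithinAt (fun σ => ∫ r in (0 : ℝ)..σ, A r) (Icc 0 1) 1 := by
      have := intervalIntegral.continuousOn_primitive_interval
        (f := A) (μ := volume) (a := 0) (b := 1) (by
          rw [uIcc_of_le zero_le_one, integrableOn_Icc_iff_integrableOn_Ioc]
          exact (intervalIntegrable_iff_integrableOn_Ioc_of_le zero_le_one).1 hA)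
      rw [uIcc_of_le zero_le_one] at this
      exact this 1 (right_mem_Icc.2 zero_le_one)
    have h1 : Tendsto (fun σ => ∫ r in (0 : ℝ)..σ, A r) (𝓝[Ico 0 1] 1)
        (𝓝 (∫ r in (0 : ℝ)..1, A r)) := hcont.mono_left (nhdsWithin_mono _ Ico_subset_Icc_self)
    have h2 : Tendsto (fun σ => ∫ r in (0 : ℝ)..σ, A r) (𝓝[Ico 0 1] 1) (𝓝 0) := by
      refine tendsto_const_nhds.congr' ?_
      filter_upwards [self_mem_nhdsWithin] with σ hσ
      rw [← htri σ hσ.1, hlt σ hσ]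
    have : (𝓝[Ico (0 : ℝ) 1] 1).NeBot := by
      rw [← mem_closure_iff_nhdsWithin_neBot, closure_Ico zero_ne_one]
      exact right_mem_Icc.2 zero_le_one
    exact tendsto_nhds_unique h1 h2

theorem laplaceWeight_one_div_nat (b G : ℝ → ℝ → 𝕜) (t : ℝ) (n : ℕ) :
    laplaceWeight b G t (1 / (n : ℝ)) =
      ((n : ℝ) : 𝕜) * (∫ s in (0 : ℝ)..1, ((Real.exp (-(n * s)) : ℝ) : 𝕜) * b t s) +
        ((Real.exp (-n) : ℝ) : 𝕜) * G t (1 / (n : ℝ)) := by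
  have : ∀ s : ℝ, -s / (1 / (n : ℝ)) = -(n * s) := fun s => by
    rw [div_div_eq_mul_div, div_one]
    ring
  simp only [laplaceWeight, one_div_one_div, this, mul_one]

theorem norm_integral_exp_smul_le_of_laplaceWeight_bound {b c G : ℝ → ℝ → 𝕜} {a : ℝ → 𝕜}
    (ha : Integrable a) (hc : Continuous fun p : ℝ × ℝ => c p.1 p.2)
    {Cc : ℝ} (hCc : ∀ t s, ‖c t s‖ ≤ Cc)
    (hbc : ∀ t ∈ Icc (0 : ℝ) 1, ∀ s ∈ Icc (0 : ℝ) 1, c t s = b t s)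
    {n : ℕ} (hn : 1 ≤ n)
    (hGm : AEStronglyMeasurable (fun t => G t (1 / (n : ℝ))) (volume.restrict (Icc 0 1)))
    {CG : ℝ} (hG : ∀ᵐ t ∂(volume.restrict (Icc (0 : ℝ) 1)), ‖G t (1 / (n : ℝ))‖ ≤ CG) {C : ℝ}
    (hC : ‖∫ t in Icc (0 : ℝ) 1, ((Real.exp (-(n * t)) : ℝ) : 𝕜) *
      laplaceWeight b G t (1 / (n : ℝ)) * a t‖ ≤ C * Real.exp (-n)) :
    ‖∫ p : ℝ × ℝ, Real.exp (n * (1 - p.1 - p.2)) • (a p.1 * c p.1 p.2)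
      ∂((volume.restrict (Icc (0 : ℝ) 1)).prod (volume.restrict (Icc (0 : ℝ) 1)))‖ ≤
      C + CG * ∫ t in Icc (0 : ℝ) 1, ‖a t‖ := by
  set μ := volume.restrict (Icc (0 : ℝ) 1) with hμ
  have hn0 : (1 : ℝ) ≤ n := by exact_mod_cast hn
  set g : ℝ × ℝ → 𝕜 := fun p => a p.1 * (((Real.exp (n * (1 - p.1 - p.2)) : ℝ) : 𝕜) * c p.1 p.2)
    with hg
  have hgint : Integrable g (μ.prod μ) := by
    have hcont : Continuous fun p : ℝ × ℝ =>
        ((Real.exp (n * (1 - p.1 - p.2)) : ℝ) : 𝕜) * c p.1 p.2 :=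
      (RCLike.continuous_ofReal.comp (by fun_prop)).mul hc
    refine Integrable.mul_bdd (c := Real.exp n * Cc)
      ((ha.restrict (s := Icc (0 : ℝ) 1)).comp_fst μ) hcont.aestronglyMeasurable ?_
    rw [hμ, Measure.prod_restrict]
    filter_upwards [ae_restrict_mem (measurableSet_Icc.prod measurableSet_Icc)] with p hp
    rw [norm_mul, RCLike.norm_ofReal, Real.abs_exp]
    refine mul_le_mul (Real.exp_le_exp.2 ?_) (hCc _ _) (norm_nonneg _) (Real.exp_pos _).le
    have h1 := hp.1.1
    have h2 := hp.2.1
    nlinarith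
  have hinner : ∀ t ∈ Icc (0 : ℝ) 1, ∫ s, g (t, s) ∂μ =
      ((Real.exp (n * (1 - t)) : ℝ) : 𝕜) *
        (∫ s in (0 : ℝ)..1, ((Real.exp (-(n * s)) : ℝ) : 𝕜) * b t s) * a t := by
    intro t ht
    rw [intervalIntegral.integral_of_le zero_le_one, ← integral_Icc_eq_integral_Ioc,
      ← integral_const_mul, ← integral_mul_const]
    refine setIntegral_congr_fun measurableSet_Icc fun s hs => ?_
    have hexp : Real.exp (n * (1 - t - s)) = Real.exp (n * (1 - t)) * Real.exp (-(n * s)) := by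
      rw [← Real.exp_add]
      ring_nf
    simp only [hg, hbc t ht s hs, hexp, RCLike.ofReal_mul]
    ring
  have hfst : Integrable (fun t => ((Real.exp (n * (1 - t)) : ℝ) : 𝕜) *
      (∫ s in (0 : ℝ)..1, ((Real.exp (-(n * s)) : ℝ) : 𝕜) * b t s) * a t) μ :=
    hgint.integral_prod_left.congr (by
      filter_upwards [ae_restrict_mem measurableSet_Icc] with t ht using hinner t ht)
  have hsnd : Integrable (fun t => ((Real.exp (-(n * t)) : ℝ) : 𝕜) * G t (1 / (n : ℝ)) * a t) μ := by
    have hcont : Continuous fun t : ℝ => ((Real.exp (-(n * t)) : ℝ) : 𝕜) :=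
      RCLike.continuous_ofReal.comp (by fun_prop)
    refine Integrable.bdd_mul (c := 1 * CG) ha.restrict (hcont.aestronglyMeasurable.mul hGm) ?_
    filter_upwards [hG, ae_restrict_mem measurableSet_Icc] with t h1 ht
    rw [norm_mul, RCLike.norm_ofReal, Real.abs_exp]
    refine mul_le_mul (Real.exp_le_one_iff.2 ?_) h1 (norm_nonneg _) zero_le_one
    have := ht.1
    nlinarith
  have hsndle : ‖∫ t, ((Real.exp (-(n * t)) : ℝ) : 𝕜) * G t (1 / (n : ℝ)) * a t ∂μ‖ ≤
      CG * ∫ t, ‖a t‖ ∂μ := by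
    rw [← integral_const_mul]
    refine norm_integral_le_of_norm_le (ha.restrict.norm.const_mul _) ?_
    filter_upwards [hG, ae_restrict_mem measurableSet_Icc] with t h1 ht
    rw [norm_mul, norm_mul, RCLike.norm_ofReal, Real.abs_exp]
    refine mul_le_mul_of_nonneg_right ?_ (norm_nonneg _)
    refine (mul_le_of_le_one_left (norm_nonneg _) (Real.exp_le_one_iff.2 ?_)).trans h1
    have := ht.1
    nlinarith
  have hmain : ∫ p : ℝ × ℝ, Real.exp (n * (1 - p.1 - p.2)) • (a p.1 * c p.1 p.2) ∂(μ.prod μ) =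
      ∫ t, ((Real.exp (n * (1 - t)) : ℝ) : 𝕜) *
        (∫ s in (0 : ℝ)..1, ((Real.exp (-(n * s)) : ℝ) : 𝕜) * b t s) * a t ∂μ := by
    rw [← setIntegral_congr_fun measurableSet_Icc hinner, ← integral_prod _ hgint]
    congr 1
    ext p
    rw [RCLike.real_smul_eq_coe_mul, mul_left_comm]
  set I₁ := ∫ t, ((Real.exp (n * (1 - t)) : ℝ) : 𝕜) *
        (∫ s in (0 : ℝ)..1, ((Real.exp (-(n * s)) : ℝ) : 𝕜) * b t s) * a t ∂μ with hI₁
  set I₂ := ∫ t, ((Real.exp (-(n * t)) : ℝ) : 𝕜) * G t (1 / (n : ℝ)) * a t ∂μ with hI₂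
  have hsplit : ∫ t, ((Real.exp (-(n * t)) : ℝ) : 𝕜) * laplaceWeight b G t (1 / (n : ℝ)) * a t ∂μ =
      ((Real.exp (-n) : ℝ) : 𝕜) * (((n : ℝ) : 𝕜) * I₁ + I₂) := by
    rw [hI₁, hI₂, ← integral_const_mul, ← integral_add (hfst.const_mul _) hsnd, ← integral_const_mul]
    congr 1
    ext t
    have hexp : Real.exp (-(n * t)) = Real.exp (-n) * Real.exp (n * (1 - t)) := by
      rw [← Real.exp_add]
      ring_nf
    rw [laplaceWeight_one_div_nat]
    have hexp' : ((Real.exp (-(n * t)) : ℝ) : 𝕜) =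
        ((Real.exp (-n) : ℝ) : 𝕜) * ((Real.exp (n * (1 - t)) : ℝ) : 𝕜) := by
      rw [hexp, RCLike.ofReal_mul]
    linear_combination (((n : ℝ) : 𝕜) *
      (∫ s in (0 : ℝ)..1, ((Real.exp (-(n * s)) : ℝ) : 𝕜) * b t s) * a t) * hexp'
  rw [hsplit, norm_mul, RCLike.norm_ofReal, Real.abs_exp, mul_comm C] at hC
  have hsum : ‖((n : ℝ) : 𝕜) * I₁ + I₂‖ ≤ C := le_of_mul_le_mul_left hC (Real.exp_pos _)
  rw [hmain]
  calc ‖I₁‖ ≤ n * ‖I₁‖ := le_mul_of_one_le_left (norm_nonneg _) hn0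
    _ = ‖((n : ℝ) : 𝕜) * I₁‖ := by rw [norm_mul, RCLike.norm_ofReal, abs_of_nonneg (by linarith)]
    _ = ‖((n : ℝ) : 𝕜) * I₁ + I₂ - I₂‖ := by rw [add_sub_cancel_right]
    _ ≤ ‖((n : ℝ) : 𝕜) * I₁ + I₂‖ + ‖I₂‖ := norm_sub_le _ _
    _ ≤ _ := add_le_add hsum hsndle

theorem ae_eq_zero_of_laplaceWeight_bound (b G : ℝ → ℝ → 𝕜) (a : ℝ → 𝕜)
    (hb : ContinuousOn (fun p : ℝ × ℝ => b p.1 p.2) unitSquare)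
    (hbd : ∀ t ∈ Icc (0 : ℝ) 1, DifferentiableOn ℝ (b t) (Icc 0 1))
    (hbd' : ContinuousOn (fun p : ℝ × ℝ => derivWithin (b p.1) (Icc 0 1) p.2) unitSquare)
    (hb0 : ∀ t ∈ Icc (0 : ℝ) 1, b t 0 ≠ 0)
    (hGm : ∀ n : ℕ, 1 ≤ n →
      AEStronglyMeasurable (fun t => G t (1 / (n : ℝ))) (volume.restrict (Icc 0 1)))
    {CG : ℝ} (hG : ∀ n : ℕ, 1 ≤ n →
      ∀ᵐ t ∂(volume.restrict (Icc (0 : ℝ) 1)), ‖G t (1 / (n : ℝ))‖ ≤ CG)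
    (ha : IntegrableOn a (Icc 0 1)) {C : ℝ}
    (hC : ∀ n : ℕ, 1 ≤ n → ∀ x : ℝ, x = 1 / (n : ℝ) →
      ‖∫ t in (0 : ℝ)..1, ((Real.exp (-t / x) : ℝ) : 𝕜) * laplaceWeight b G t x * a t‖ ≤
        C * Real.exp (-1 / x)) :
    ∀ᵐ t ∂(volume.restrict (Icc (0 : ℝ) 1)), a t = 0 := by
  set π : ℝ → ℝ := fun t => projIcc (0 : ℝ) 1 zero_le_one t with hπ
  have hπc : Continuous π := continuous_subtype_val.comp continuous_projIcc
  have hπm : ∀ t, π t ∈ Icc (0 : ℝ) 1 := fun t => (projIcc (0 : ℝ) 1 zero_le_one t).2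
  have hπe : ∀ t ∈ Icc (0 : ℝ) 1, π t = t := fun t ht => by
    simp only [hπ, projIcc_of_mem _ ht]
  have hπ2 : Continuous fun p : ℝ × ℝ => (π p.1, π p.2) := by fun_prop
  have hπ2m : ∀ p : ℝ × ℝ, (π p.1, π p.2) ∈ unitSquare := fun p => ⟨hπm _, hπm _⟩
  have hsq : IsCompact unitSquare := isCompact_Icc.prod isCompact_Icc
  obtain ⟨Cc, hCc⟩ := hsq.exists_bound_of_continuousOn hb
  obtain ⟨Cd, hCd⟩ := hsq.exists_bound_of_continuousOn hbd'
  set a' : ℝ → 𝕜 := (Icc (0 : ℝ) 1).indicator a with ha'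
  have ha'int : Integrable a' := ha.integrable_indicator measurableSet_Icc
  have ha'e : ∀ t ∈ Icc (0 : ℝ) 1, a' t = a t := fun t ht => indicator_of_mem ht a
  have h0 : (0 : ℝ) ∈ Icc (0 : ℝ) 1 := left_mem_Icc.2 zero_le_one
  have hzero := ae_eq_zero_of_laplace_moments_bounded ha'int (c := fun t s => b (π t) (π s))
    (d := fun t s => derivWithin (b (π t)) (Icc 0 1) (π s))
    (hb.comp_continuous hπ2 hπ2m) (hbd'.comp_continuous hπ2 hπ2m)
    (fun t s => hCc (π t, π s) (hπ2m (t, s))) (fun t s => hCd (π t, π s) (hπ2m (t, s)))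
    (fun t ht s hs => ?_) (fun t ht => by simpa only [hπe t ht, hπe 0 h0] using hb0 t ht)
    (M := C + CG * ∫ t in Icc (0 : ℝ) 1, ‖a' t‖) (fun n hn => ?_)
  · filter_upwards [hzero, ae_restrict_mem measurableSet_Icc] with t h1 ht
    rw [← ha'e t ht, h1]
  · have hcd : Continuous fun s => derivWithin (b t) (Icc 0 1) (π s) :=
      hbd'.comp_continuous (f := fun s => (t, π s)) (by fun_prop) fun s => ⟨ht, hπm s⟩
    have h := intervalIntegral.integral_eq_sub_of_hasDerivAt_of_le (f := b t)
      (f' := fun s => derivWithin (b t) (Icc 0 1) (π s)) hs.1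
      ((hbd t ht).continuousOn.mono (Icc_subset_Icc_right hs.2)) (fun x hx => ?_)
      (hcd.intervalIntegrable _ _)
    · simp only [hπe t ht, hπe s hs, hπe 0 h0]
      rw [h, add_sub_cancel]
    · have hx01 : x ∈ Icc (0 : ℝ) 1 := ⟨hx.1.le, hx.2.le.trans hs.2⟩
      rw [hπe x hx01]
      exact (hbd t ht x hx01).hasDerivWithinAt.hasDerivAt
        (Icc_mem_nhds hx.1 (hx.2.trans_le hs.2))
  · refine norm_integral_exp_smul_le_of_laplaceWeight_bound (b := b) (G := G)
      (c := fun t s => b (π t) (π s)) ha'int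
      (hb.comp_continuous hπ2 hπ2m) (fun t s => hCc (π t, π s) (hπ2m (t, s)))
      (fun t ht s hs => by simp only [hπe t ht, hπe s hs]) hn (hGm n hn) (hG n hn) ?_
    have h := hC n hn _ rfl
    have hdiv : ∀ s : ℝ, -s / (1 / (n : ℝ)) = -(n * s) := fun s => by
      rw [div_div_eq_mul_div, div_one]
      ring
    simp only [hdiv, mul_one] at h
    rw [intervalIntegral.integral_of_le zero_le_one, ← integral_Icc_eq_integral_Ioc] at h
    refine le_of_eq_of_le (congrArg norm ?_) h
    exact setIntegral_congr_fun measurableSet_Icc fun t ht => by simp only [ha'e t ht]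

end LaplaceWeight

theorem theorem1p2 :
    -- (I) failure of uniqueness for smooth weights
    (∃ (Q : ℝ → ℝ → ℝ) (b : ℝ → ℝ),
      ContDiffOn ℝ ∞ (fun p : ℝ × ℝ => Q p.1 p.2) unitSquare ∧
      (∀ s ∈ Icc (0 : ℝ) 1, ∀ x ∈ Icc (0 : ℝ) 1, 0 < Q s x) ∧
      (∀ s ∈ Icc (1 / 3 : ℝ) 1, ∀ x ∈ Icc (0 : ℝ) 1, Q s x = 1) ∧
      IsSmoothCompactlySupportedIco (1 / 3) b ∧
      (∃ s ∈ Ico (0 : ℝ) (1 / 3), b s ≠ 0) ∧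
      ∃ δ ∈ Ioc (0 : ℝ) 1, ∀ x ∈ Ioc (0 : ℝ) δ,
        ∫ s in (0 : ℝ)..1, Real.exp (-s / x) * Q s x * b s = 0) ∧
    -- (II) uniqueness for weights of Laplace type (real or complex valued)
    (∀ (𝕜 : Type) [RCLike 𝕜] (b G : ℝ → ℝ → 𝕜) (a : ℝ → 𝕜),
      -- `b` and `∂b/∂s` are continuous on the closed square, and `b(t,0) > 0`
      ContinuousOn (fun p : ℝ × ℝ => b p.1 p.2) unitSquare →
      (∀ t ∈ Icc (0 : ℝ) 1, DifferentiableOn ℝ (b t) (Icc 0 1)) →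
      ContinuousOn (fun p : ℝ × ℝ => derivWithin (b p.1) (Icc 0 1) p.2) unitSquare →
      (∀ t ∈ Icc (0 : ℝ) 1, ∃ r : ℝ, 0 < r ∧ b t 0 = (r : 𝕜)) →
      -- the slices `G(·,1/n)`, `n ≥ 1`, are measurable and uniformly essentially bounded
      (∀ n : ℕ, 1 ≤ n →
        AEStronglyMeasurable (fun t => G t (1 / (n : ℝ))) (volume.restrict (Icc 0 1))) →
      (∃ C : ℝ, ∀ n : ℕ, 1 ≤ n →
        ∀ᵐ t ∂(volume.restrict (Icc (0 : ℝ) 1)), ‖G t (1 / (n : ℝ))‖ ≤ C) →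
      IntegrableOn a (Icc 0 1) →
      -- the weighted Laplace transform of `a` is `O(e^{-1/x})` along `x = 1/n`
      (∃ C : ℝ, ∀ n : ℕ, 1 ≤ n → ∀ x : ℝ, x = 1 / (n : ℝ) →
        ‖∫ t in (0 : ℝ)..1, ((Real.exp (-t / x) : ℝ) : 𝕜) * laplaceWeight b G t x * a t‖ ≤
          C * Real.exp (-1 / x)) →
      ∀ᵐ t ∂(volume.restrict (Icc (0 : ℝ) 1)), a t = 0) := by
  refine ⟨?_, ?_⟩
  · obtain ⟨Q, b, hQ, hQ0, hQ1, hb, hb0, hb1, hne, hδ⟩ := exists_positive_weight_laplace_eq_zero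
    refine ⟨Q, b, hQ.contDiffOn, fun s _ x _ => hQ0 s x,
      fun s hs x _ => hQ1 s (by linarith [hs.1]) x, ⟨hb.contDiffOn, Icc 0 (1 / 4), isCompact_Icc,
      fun s hs => ⟨hs.1, by linarith [hs.2]⟩, fun s hs => ?_⟩, hne, hδ⟩
    rcases le_or_gt s 0 with h | h
    · exact hb0 s h
    · refine hb1 s (not_lt.1 fun h' => hs ⟨h.le, h'.le⟩)
  · rintro 𝕜 _ b G a hb hbd hbd' hb0 hGm ⟨CG, hG⟩ ha ⟨C, hC⟩
    refine ae_eq_zero_of_laplaceWeight_bound b G a hb hbd hbd' (fun t ht => ?_) hGm hG ha hC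
    obtain ⟨r, hr, h⟩ := hb0 t ht
    rw [h]
    exact RCLike.ofReal_ne_zero.2 hr.ne'
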